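/- Let $\mathcal{C}^2$ be the set of first-order formulas containing at most two variables $x,y$, built from atoms $p(u)$, $r(u,v)$ and $u\approx v$ (where $p$ is a unary predicate, $r$ is a binary predicate, $\approx$ denotes equality, $u,v\in\{x,y\}$, and there are no individual constants or function symbols) by means of the Boolean connectives $\neg,\wedge,\vee,\rightarrow,\leftrightarrow$, the quantifiers $\forall,\exists$, and the counting quantifiers $\exists_{\le C}$, $\exists_{\ge C}$, $\exists_{=C}$ ("there exist at most / at least / exactly $C$") for all integers $C>0$. For $\varphi\in\mathcal{C}^2$ let $\lVert\varphi\rVert$ be the number of symbols in $\varphi$, where a numerical quantifier subscript $C$ counts as $\lfloor\log_2 C\rfloor$ symbols (binary coding) and brackets and commas are not counted. Structures have non-empty domains, and $\varphi$ is satisfied in a structure if it is true there under some assignment of elements to $x,y$ (for a sentence: if the structure is a model of it); $\varphi$ is finitely satisfiable if it is satisfied in some structure with a finite domain. There is a polynomial $p$ with coefficients in $\mathbb{N}$ such that every finitely satisfiable formula $\varphi$ of $\mathcal{C}^2$ is satisfied in a structure whose domain is finite and has at most $$2^{2^{p(\lVert\varphi\rVert)}}$$ elements; that is, the size of the structure is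 bounded by a fixed doubly exponential function of $\lVert\varphi\rVert$. -/

import Mathlib

universe u

namespace C2

open FirstOrder

/-- The predicates of arity `n` in a signature with unary predicates `P` and binary predicates
`R`. -/
def Predicate (P R : Type u) : ℕ → Type u
  | 1 => P
  | 2 => R
  | _ => PEmpty

/-- The relational signature whose unary predicates are the elements of `P` and whose binary
predicates are the elements of `R`; there are no individual constants, no function symbols, and no
predicates of any other arity. -/
abbrev sig (P R : Type u) : FirstOrder.Language.{0, u} where
  Functions _ := Empty
  Relations := Predicate P R

/-- Formulas of the two-variable fragment with counting quantifiers over unary predicates `P` and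
binary predicates `R`. The two variables are `0, 1 : Fin 2`. Equality is a logical constant.
The numerical subscripts of counting quantifiers are positive. -/
inductive Formula (P R : Type u) : Type u
  | eq (i j : Fin 2)
  | unary (p : P) (i : Fin 2)
  | binary (r : R) (i j : Fin 2)
  | neg (φ : Formula P R)
  | and (φ ψ : Formula P R)
  | or (φ ψ : Formula P R)
  | imp (φ ψ : Formula P R)
  | iff (φ ψ : Formula P R)
  | all (i : Fin 2) (φ : Formula P R)
  | ex (i : Fin 2) (φ : Formula P R)
  | exLE (C : ℕ+) (i : Fin 2) (φ : Formula P R)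
  | exGE (C : ℕ+) (i : Fin 2) (φ : Formula P R)
  | exEQ (C : ℕ+) (i : Fin 2) (φ : Formula P R)

namespace Formula

variable {P R : Type u}

/-- The number of symbols of a formula (predicates, variables, connectives, quantifiers; brackets
and commas are not counted), where a numerical subscript `C` counts for `log C` symbols
(binary coding; the logarithm is rounded down). -/
def size : Formula P R → ℕ
  | eq _ _ => 3
  | unary _ _ => 2
  | binary _ _ _ => 3
  | neg φ => φ.size + 1
  | and φ ψ => φ.size + ψ.size + 1
  | or φ ψ => φ.size + ψ.size + 1
  | imp φ ψ => φ.size + ψ.size + 1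
  | iff φ ψ => φ.size + ψ.size + 1
  | all _ φ => φ.size + 2
  | ex _ φ => φ.size + 2
  | exLE C _ φ => φ.size + 2 + Nat.log 2 C
  | exGE C _ φ => φ.size + 2 + Nat.log 2 C
  | exEQ C _ φ => φ.size + 2 + Nat.log 2 C

/-- Truth of a formula in a structure with domain `A` under the assignment `v` of elements of `A`
to the two variables. Witnesses of counting quantifiers are counted by `Set.encard`, so the
definition is also the usual one over infinite domains. -/
def Realize {A : Type*} [(sig P R).Structure A] : Formula P R → (Fin 2 → A) → Prop
  | eq i j, v => v i = v j
  | unary p i, v =>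
      Language.Structure.RelMap (L := sig P R) (n := 1) (M := A) p ![v i]
  | binary r i j, v =>
      Language.Structure.RelMap (L := sig P R) (n := 2) (M := A) r ![v i, v j]
  | neg φ, v => ¬ φ.Realize v
  | and φ ψ, v => φ.Realize v ∧ ψ.Realize v
  | or φ ψ, v => φ.Realize v ∨ ψ.Realize v
  | imp φ ψ, v => φ.Realize v → ψ.Realize v
  | iff φ ψ, v => (φ.Realize v ↔ ψ.Realize v)
  | all i φ, v => ∀ a : A, φ.Realize (Function.update v i a)
  | ex i φ, v => ∃ a : A, φ.Realize (Function.update v i a)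
  | exLE C i φ, v => {a : A | φ.Realize (Function.update v i a)}.encard ≤ (C : ℕ)
  | exGE C i φ, v => ((C : ℕ) : ℕ∞) ≤ {a : A | φ.Realize (Function.update v i a)}.encard
  | exEQ C i φ, v => {a : A | φ.Realize (Function.update v i a)}.encard = (C : ℕ)

/-- `φ` is satisfied in the structure `A`: it is true under some assignment. For a sentence this
says that `A` is a (non-empty) model of `φ`, since the truth value of a sentence does not depend
on the assignment. An assignment exists only if `A` is non-empty. -/
def SatisfiedIn (φ : Formula P R) (A : Type*) [(sig P R).Structure A] : Prop :=
  ∃ v : Fin 2 → A, φ.Realize v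

/-- `φ` is satisfied in some finite (non-empty) structure. Since every finite set is in bijection
with one in the lowest universe, it is enough to speak of domains in `Type`. -/
def FinitelySatisfiable (φ : Formula P R) : Prop :=
  ∃ (A : Type) (_ : Finite A) (_ : (sig P R).Structure A), φ.SatisfiedIn A

end Formula

end C2

/-! Start from a finite model. For every element and quantified subformula, choose witnesses, as
many as exist up to a cap that is at most exponential in the size of the formula, and let the
element send a message to each chosen witness. Every element then sends at most exponentially many
messages, and pairs have at most exponentially many labels. A set of elements with relabelled pairs
is again a model if each pair copies the label of an old pair with the same diagonal labels at its
ends, and each element sends every message label as often as before.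

To find a small such set, colour the elements so that mutual message partners of one element are
told apart by colour. The elements in small classes (of diagonal label and colour) are few, and all
of them are kept. In the large classes, messages that are not answered can be redirected to any
elements of the right class, but mutual messages must be matched in pairs. Recording for each
element and each label of a mutual edge whether the element is a source or a target gives vectors
with entries in {-1, 0, 1} whose total sum is zero; on any subset with zero sum the mutual edges can
be matched again.

It remains to find a small zero-sum subset that contains prescribed elements. By a Steinitz-type
argument, a large zero-sum family has a long chain of subsets whose sums stay in a box; by
pigeonhole two sums agree, and the difference of the two subsets is a smaller zero-sum family.
Minimal zero-sum families in dimension `d` therefore have at most `(2 * d + 1) ^ d + d` members.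
Here `d` is exponential in the size of the formula, which gives a double exponential. -/

/-! ### Small zero-sum subfamilies (Steinitz argument) -/

/-- A point of a cube can be moved, without changing a given linear image of it, so that few of
its coordinates are fractional. -/
theorem exists_card_fractional_le_finrank {ι V : Type*} [AddCommGroup V] [Module ℝ V]
    [FiniteDimensional ℝ V] (v : ι → V) (s : Finset ι) (x : ι → ℝ)
    (hx : ∀ i ∈ s, x i ∈ Set.Icc (0 : ℝ) 1) :
    ∃ y : ι → ℝ, (∀ i ∈ s, y i ∈ Set.Icc (0 : ℝ) 1) ∧
      ∑ i ∈ s, y i • v i = ∑ i ∈ s, x i • v i ∧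
      ∃ F ⊆ s, F.card ≤ Module.finrank ℝ V ∧ ∀ i ∈ s, i ∉ F → y i = 0 ∨ y i = 1 := by
  classical
  suffices H : ∀ n : ℕ, ∀ x : ι → ℝ, (∀ i ∈ s, x i ∈ Set.Icc (0 : ℝ) 1) →
      (s.filter fun i => x i ≠ 0 ∧ x i ≠ 1).card = n →
      ∃ y : ι → ℝ, (∀ i ∈ s, y i ∈ Set.Icc (0 : ℝ) 1) ∧
      ∑ i ∈ s, y i • v i = ∑ i ∈ s, x i • v i ∧
      ∃ F ⊆ s, F.card ≤ Module.finrank ℝ V ∧ ∀ i ∈ s, i ∉ F → y i = 0 ∨ y i = 1 from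
    H _ x hx rfl
  clear hx x
  intro n
  induction n using Nat.strong_induction_on with
  | _ n ih =>
  intro x hx hn
  set F := s.filter fun i => x i ≠ 0 ∧ x i ≠ 1 with hF
  by_cases hle : F.card ≤ Module.finrank ℝ V
  · refine ⟨x, hx, rfl, F, Finset.filter_subset _ _, hle, fun i hi hiF => ?_⟩
    by_contra! h
    exact hiF (Finset.mem_filter.2 ⟨hi, h⟩)
  have hdep : ¬ LinearIndependent ℝ (fun i : F => v i) := fun h => hle (by
    simpa using h.fintype_card_le_finrank)
  obtain ⟨g₀, hg₀, i₀, hi₀⟩ := Fintype.not_linearIndependent_iff.1 hdep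
  let g : ι → ℝ := fun i => if h : i ∈ F then g₀ ⟨i, h⟩ else 0
  have hgF : ∀ i, i ∉ F → g i = 0 := fun i hi => by simp [g, hi]
  have hgsum : ∑ i ∈ s, g i • v i = 0 := by
    rw [← Finset.sum_subset (Finset.filter_subset _ s : F ⊆ s)
      (fun i _ hi => by rw [hgF i hi, zero_smul]), ← hg₀, ← Finset.sum_coe_sort]
    exact Finset.sum_congr rfl fun i _ => by simp [g]
  have hFx : ∀ i ∈ F, 0 < x i ∧ x i < 1 := fun i hi => by
    obtain ⟨h1, h2, h3⟩ := Finset.mem_filter.1 hi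
    exact ⟨lt_of_le_of_ne (hx i h1).1 (Ne.symm h2), lt_of_le_of_ne (hx i h1).2 h3⟩
  -- `δ i` is the time at which coordinate `i` leaves the cube along the dependency `g`. Stopping at
  -- the smallest such time makes one more coordinate integral.
  let δ : ι → ℝ := fun i => if 0 < g i then (1 - x i) / g i else x i / (- g i)
  have hne : (F.filter fun i => g i ≠ 0).Nonempty :=
    ⟨i₀, Finset.mem_filter.2 ⟨i₀.2, by simpa [g] using hi₀⟩⟩
  obtain ⟨k, hk, hkmin⟩ := Finset.exists_min_image _ δ hne
  obtain ⟨hkF, hgk⟩ := Finset.mem_filter.1 hk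
  have hδ : 0 ≤ δ k := by
    have := hFx k hkF
    simp only [δ]
    split_ifs with h
    · exact div_nonneg (by linarith) h.le
    · exact div_nonneg this.1.le (by linarith)
  have hy : ∀ i ∈ s, x i + δ k * g i ∈ Set.Icc (0 : ℝ) 1 := by
    intro i hi
    by_cases hiF : i ∈ F
    · have hxi := hFx i hiF
      by_cases hgi : g i = 0
      · simpa [hgi] using hx i hi
      have hm := hkmin i (Finset.mem_filter.2 ⟨hiF, hgi⟩)
      rcases lt_or_gt_of_ne hgi with hneg | hpos
      · have h2 : δ i = x i / (- g i) := by simp [δ, not_lt.2 hneg.le]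
        rw [h2, le_div_iff₀ (by linarith)] at hm
        constructor
        · linarith
        · nlinarith [mul_nonneg hδ (neg_nonneg.2 hneg.le)]
      · have h2 : δ i = (1 - x i) / g i := by simp [δ, hpos]
        rw [h2, le_div_iff₀ hpos] at hm
        constructor
        · nlinarith [mul_nonneg hδ hpos.le]
        · linarith
    · simpa [hgF i hiF] using hx i hi
  have hyk : x k + δ k * g k = 0 ∨ x k + δ k * g k = 1 := by
    rcases lt_or_gt_of_ne hgk with hneg | hpos
    · left
      have h2 : δ k = x k / (- g k) := by simp [δ, not_lt.2 hneg.le]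
      rw [h2]; field_simp; ring
    · right
      have h2 : δ k = (1 - x k) / g k := by simp [δ, hpos]
      rw [h2]; field_simp; ring
  have hlt : (s.filter fun i => x i + δ k * g i ≠ 0 ∧ x i + δ k * g i ≠ 1).card < n := by
    rw [← hn]
    refine Finset.card_lt_card ((Finset.ssubset_iff_of_subset fun i hi => ?_).2 ⟨k, hkF, ?_⟩)
    · obtain ⟨h1, h2, h3⟩ := Finset.mem_filter.1 hi
      by_contra hiF
      rw [hgF i hiF, mul_zero, add_zero] at h2 h3
      exact hiF (Finset.mem_filter.2 ⟨h1, h2, h3⟩)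
    · intro h
      rcases hyk with h' | h'
      · exact (Finset.mem_filter.1 h).2.1 h'
      · exact (Finset.mem_filter.1 h).2.2 h'
  obtain ⟨y, hy1, hy2, hy3⟩ := ih _ hlt (fun i => x i + δ k * g i) hy rfl
  refine ⟨y, hy1, hy2.trans ?_, hy3⟩
  simp only [add_smul, mul_smul, Finset.sum_add_distrib, ← Finset.smul_sum, hgsum, smul_zero,
    add_zero]

section ZeroSum

variable {ι J : Type*} [Fintype J]

/-- The condition on a set of vectors that keeps its sum bounded in the proof of the Steinitz
lemma. -/
def SteinitzBalanced (v : ι → J → ℤ) (s : Finset ι) : Prop :=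
  ∃ c : ι → ℝ, (∀ i ∈ s, c i ∈ Set.Icc (0 : ℝ) 1) ∧
    ∑ i ∈ s, c i = s.card - Fintype.card J ∧ ∀ j, ∑ i ∈ s, c i * v i j = 0

/-- As the sum weighted by `c` vanishes, the plain sum equals the one weighted by `1 - c`, and these
nonnegative weights have total `Fintype.card J`. -/
theorem SteinitzBalanced.abs_sum_le {v : ι → J → ℤ} {s : Finset ι} (hv : ∀ i j, |v i j| ≤ 1)
    (h : SteinitzBalanced v s) (j : J) : |∑ i ∈ s, v i j| ≤ Fintype.card J := by
  obtain ⟨c, hc, hsum, h0⟩ := h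
  have hR : |∑ i ∈ s, (v i j : ℝ)| ≤ Fintype.card J := by
    calc |∑ i ∈ s, (v i j : ℝ)| = |∑ i ∈ s, (1 - c i) * v i j| := by
          simp [sub_mul, Finset.sum_sub_distrib, h0]
      _ ≤ ∑ i ∈ s, |(1 - c i) * v i j| := Finset.abs_sum_le_sum_abs _ _
      _ ≤ ∑ i ∈ s, (1 - c i) := Finset.sum_le_sum fun i hi => by
          have h1 : |(v i j : ℝ)| ≤ 1 := by exact_mod_cast hv i j
          have h2 : 0 ≤ 1 - c i := by linarith [(hc i hi).2]
          rw [abs_mul, abs_of_nonneg h2]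
          exact mul_le_of_le_one_right h2 h1
      _ = Fintype.card J := by
          rw [Finset.sum_sub_distrib, hsum]; simp
  exact_mod_cast hR

/-- Scale the weights to total `s.card - 1 - d` and make all but `d + 1` of them integral; the total
is an extra coordinate to be preserved. If no weight were zero, all the integral ones would be 1 and
the total would be too large. An index of weight zero can be erased. -/
theorem SteinitzBalanced.exists_erase [DecidableEq ι] {v : ι → J → ℤ} {s : Finset ι}
    (h : SteinitzBalanced v s) (hs : Fintype.card J < s.card) :
    ∃ i ∈ s, SteinitzBalanced v (s.erase i) := by
  obtain ⟨c, hc, hsum, h0⟩ := h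
  set d := Fintype.card J with hd
  have hpos : (0 : ℝ) < s.card - d := by
    have : (d : ℝ) < s.card := by exact_mod_cast hs
    linarith
  have hge : (0 : ℝ) ≤ s.card - 1 - d := by
    have : (d : ℝ) + 1 ≤ s.card := by exact_mod_cast hs
    linarith
  set r : ℝ := (s.card - 1 - d) / (s.card - d) with hr
  have hr0 : 0 ≤ r := div_nonneg hge hpos.le
  have hr1 : r ≤ 1 := (div_le_one hpos).2 (by linarith)
  obtain ⟨y, hy, hyeq, F, hFs, hF, hyF⟩ := exists_card_fractional_le_finrank
    (fun i => ((fun j => (v i j : ℝ)), (1 : ℝ))) s (fun i => r * c i)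
    (fun i hi => ⟨mul_nonneg hr0 (hc i hi).1, mul_le_one₀ hr1 (hc i hi).1 (hc i hi).2⟩)
  have hysum : ∑ i ∈ s, y i = s.card - 1 - d := by
    have h2 := congrArg Prod.snd hyeq
    simp only [Prod.snd_sum, Prod.smul_snd, smul_eq_mul, mul_one] at h2
    rw [h2, ← Finset.mul_sum, hsum, hr, div_mul_cancel₀ _ hpos.ne']
  have hy0 : ∀ j, ∑ i ∈ s, y i * v i j = 0 := by
    intro j
    have h2 := congrFun (congrArg Prod.fst hyeq) j
    simp only [Prod.fst_sum, Prod.smul_fst, Finset.sum_apply, Pi.smul_apply, smul_eq_mul,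
      mul_assoc] at h2
    rw [h2, ← Finset.mul_sum, h0, mul_zero]
  have hFd : (F.card : ℝ) ≤ d + 1 := by
    have : F.card ≤ d + 1 := by simpa using hF
    exact_mod_cast this
  obtain ⟨i, hi, hyi⟩ : ∃ i ∈ s, y i = 0 := by
    by_contra! hne
    have h1 : ∑ i ∈ s \ F, y i = (s.card : ℝ) - F.card := by
      rw [Finset.sum_congr rfl (g := fun _ => (1 : ℝ)) fun i hi => by
        obtain ⟨h1, h2⟩ := Finset.mem_sdiff.1 hi
        exact (hyF i h1 h2).resolve_left (hne i h1)]
      rw [Finset.sum_const, nsmul_eq_mul, mul_one, Finset.card_sdiff_of_subset hFs,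
        Nat.cast_sub (Finset.card_le_card hFs)]
    have h2 := Finset.sum_sdiff (f := y) hFs
    have hFpos : ∀ i ∈ F, 0 < y i := fun i hi =>
      lt_of_le_of_ne (hy i (hFs hi)).1 (Ne.symm (hne i (hFs hi)))
    rcases F.eq_empty_or_nonempty with rfl | hFne
    · simp at h1 h2
      have : (0 : ℝ) ≤ d := Nat.cast_nonneg d
      linarith
    · have := Finset.sum_pos hFpos hFne
      linarith
  refine ⟨i, hi, y, fun k hk => hy k (Finset.mem_of_mem_erase hk), ?_, fun j => ?_⟩
  · rw [Finset.sum_erase _ hyi, hysum, Finset.card_erase_of_mem hi,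
      Nat.cast_sub (Finset.card_pos.2 ⟨i, hi⟩), Nat.cast_one]
  · rw [Finset.sum_erase _ (by simp [hyi]), hy0]

theorem SteinitzBalanced.exists_chain {v : ι → J → ℤ} {s : Finset ι}
    (h : SteinitzBalanced v s) (hs : Fintype.card J < s.card) :
    ∃ F : Finset (Finset ι), IsChain (· ⊆ ·) (F : Set (Finset ι)) ∧
      F.card = s.card - Fintype.card J ∧
      ∀ u ∈ F, u ⊆ s ∧ u.Nonempty ∧ SteinitzBalanced v u := by
  classical
  induction hn : s.card generalizing s with
  | zero => omega
  | succ n ih =>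
    have hne : s.Nonempty := Finset.card_pos.1 (by omega)
    by_cases hlt : Fintype.card J < n
    · obtain ⟨i, hi, hbal⟩ := h.exists_erase hs
      have hcard : (s.erase i).card = n := by rw [Finset.card_erase_of_mem hi, hn]; rfl
      obtain ⟨F, hF, hFc, hFs⟩ := ih hbal (by omega) hcard
      have hsF : s ∉ F := fun hsF => by
        have := Finset.card_le_card (hFs s hsF).1
        omega
      refine ⟨insert s F, ?_, ?_, ?_⟩
      · rw [Finset.coe_insert]
        exact hF.insert fun u hu _ =>
          Or.inr ((hFs u hu).1.trans (Finset.erase_subset _ _))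
      · rw [Finset.card_insert_of_notMem hsF, hFc]; omega
      · intro u hu
        rcases Finset.mem_insert.1 hu with rfl | hu
        · exact ⟨subset_rfl, hne, h⟩
        · exact ⟨(hFs u hu).1.trans (Finset.erase_subset _ _), (hFs u hu).2⟩
    · refine ⟨{s}, by simp, by simp; omega, ?_⟩
      intro u hu
      rw [Finset.mem_singleton.1 hu]
      exact ⟨subset_rfl, hne, h⟩

/-- A bound on the size of minimal zero-sum families of vectors with entries in `{-1, 0, 1}`. -/
def zeroSumBound (d : ℕ) : ℕ := (2 * d + 1) ^ d + d

/-- All sums along the chain lie in a box with `(2 * d + 1) ^ d` points. When the chain is longer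
than that, two of its members have equal sums, and their difference is a nonempty zero-sum set,
proper because the members of the chain are nonempty. -/
theorem exists_zeroSum_subset {v : ι → J → ℤ} (hv : ∀ i j, |v i j| ≤ 1) {s : Finset ι}
    (hs : s.Nonempty) (h0 : ∀ j, ∑ i ∈ s, v i j = 0) :
    ∃ z ⊆ s, z.Nonempty ∧ z.card ≤ zeroSumBound (Fintype.card J) ∧ ∀ j, ∑ i ∈ z, v i j = 0 := by
  classical
  induction hn : s.card using Nat.strong_induction_on generalizing s with
  | _ n ih =>
  by_cases hle : s.card ≤ zeroSumBound (Fintype.card J)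
  · exact ⟨s, subset_rfl, hs, hle, h0⟩
  set d := Fintype.card J with hd
  have hds : d < s.card := by unfold zeroSumBound at hle; omega
  have hbal : SteinitzBalanced v s := by
    have hpos : (0 : ℝ) < s.card := by exact_mod_cast (by omega : 0 < s.card)
    have hdle : (d : ℝ) ≤ s.card := by exact_mod_cast hds.le
    refine ⟨fun _ => (s.card - d) / s.card, fun _ _ => ⟨div_nonneg (by linarith) hpos.le,
      (div_le_one hpos).2 (by linarith [(Nat.cast_nonneg d : (0 : ℝ) ≤ d)])⟩, ?_, fun j => ?_⟩
    · rw [Finset.sum_const, nsmul_eq_mul, mul_div_cancel₀ _ hpos.ne']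
    · rw [← Finset.mul_sum]
      have : ∑ i ∈ s, (v i j : ℝ) = 0 := by exact_mod_cast h0 j
      rw [this, mul_zero]
  obtain ⟨F, hF, hFc, hFs⟩ := hbal.exists_chain hds
  have hbox : ∀ u ∈ F, (fun j => ∑ i ∈ u, v i j) ∈
      Fintype.piFinset (fun _ : J => Finset.Icc (-(d : ℤ)) d) := fun u hu => by
    rw [Fintype.mem_piFinset]
    intro j
    rw [Finset.mem_Icc, ← abs_le]
    exact (hFs u hu).2.2.abs_sum_le hv j
  have hboxc : (Fintype.piFinset (fun _ : J => Finset.Icc (-(d : ℤ)) d)).card =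
      (2 * d + 1) ^ d := by
    rw [Fintype.card_piFinset, Finset.prod_const, Int.card_Icc, Finset.card_univ]
    congr 1
    omega
  obtain ⟨u, hu, w, hw, huw, heq⟩ := Finset.exists_ne_map_eq_of_card_lt_of_maps_to
    (by rw [hboxc, hFc]; unfold zeroSumBound at hle; omega) hbox
  have key : ∀ u ∈ F, ∀ w ∈ F, u ≠ w → u ⊆ w →
      (fun j => ∑ i ∈ u, v i j) = (fun j => ∑ i ∈ w, v i j) →
      ∃ z ⊆ s, z.Nonempty ∧ z.card ≤ zeroSumBound d ∧ ∀ j, ∑ i ∈ z, v i j = 0 := by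
    intro u hu w hw hne hsub heq
    have hlt : (w \ u).card < n := by
      have h1 := Finset.card_le_card (hFs w hw).1
      have h2 := Finset.card_pos.2 (hFs u hu).2.1
      rw [Finset.card_sdiff_of_subset hsub]
      have := Finset.card_le_card hsub
      omega
    obtain ⟨z, hz, hz'⟩ := ih _ hlt (s := w \ u)
      (Finset.sdiff_nonempty.2 fun h => hne (hsub.antisymm h))
      (fun j => by
        have h1 := Finset.sum_sdiff (f := fun i => v i j) hsub
        have h2 : ∑ i ∈ u, v i j = ∑ i ∈ w, v i j := congrFun heq j
        omega) rfl
    exact ⟨z, hz.trans (Finset.sdiff_subset.trans (hFs w hw).1), hz'⟩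
  rcases hF.total hu hw with h | h
  · exact key u hu w hw huw h heq
  · exact key w hw u hu huw.symm h heq.symm

/-- In a zero-sum family of vectors with entries in `{-1, 0, 1}`, every subfamily extends to a
zero-sum subfamily that is not much larger. -/
theorem exists_zeroSum_superset {v : ι → J → ℤ} (hv : ∀ i j, |v i j| ≤ 1) {s b : Finset ι}
    (hbs : b ⊆ s) (h0 : ∀ j, ∑ i ∈ s, v i j = 0) :
    ∃ z, b ⊆ z ∧ z ⊆ s ∧ z.card ≤ b.card * zeroSumBound (Fintype.card J) ∧
      ∀ j, ∑ i ∈ z, v i j = 0 := by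
  classical
  induction hn : s.card using Nat.strong_induction_on generalizing s b with
  | _ n ih =>
  rcases b.eq_empty_or_nonempty with rfl | hb
  · exact ⟨∅, by simp⟩
  obtain ⟨z, hzs, hzne, hzc, hz0⟩ := exists_zeroSum_subset hv (hb.mono hbs) h0
  have hlt : (s \ z).card < n := by
    rw [Finset.card_sdiff_of_subset hzs, hn]
    have := Finset.card_pos.2 hzne
    have := Finset.card_le_card hzs
    omega
  obtain ⟨y, hby, hys, hyc, hy0⟩ := ih _ hlt (s := s \ z) (b := b \ z)
    (Finset.sdiff_subset_sdiff hbs subset_rfl)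
    (fun j => by
      have h1 := Finset.sum_sdiff (f := fun i => v i j) hzs
      rw [h0, hz0] at h1
      omega) rfl
  -- A small zero-sum set that misses `b` is discarded. One that meets `b` is kept and covers a new
  -- element of `b`, so at most `b.card` are kept.
  by_cases hd : Disjoint b z
  · rw [Finset.sdiff_eq_self_of_disjoint hd] at hby hyc
    exact ⟨y, hby, hys.trans Finset.sdiff_subset, hyc, hy0⟩
  have hdisj : Disjoint y z := (Finset.sdiff_disjoint).mono_left hys
  refine ⟨y ∪ z, ?_, Finset.union_subset (hys.trans Finset.sdiff_subset) hzs, ?_, fun j => ?_⟩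
  · intro i hi
    by_cases hiz : i ∈ z
    · exact Finset.mem_union_right _ hiz
    · exact Finset.mem_union_left _ (hby (Finset.mem_sdiff.2 ⟨hi, hiz⟩))
  · have h1 : (b \ z).card + 1 ≤ b.card := by
      rw [Finset.not_disjoint_iff] at hd
      obtain ⟨i, hib, hiz⟩ := hd
      exact Finset.card_lt_card ((Finset.ssubset_iff_of_subset Finset.sdiff_subset).2
        ⟨i, hib, fun h => (Finset.mem_sdiff.1 h).2 hiz⟩)
    calc (y ∪ z).card ≤ y.card + z.card := Finset.card_union_le _ _
      _ ≤ ((b \ z).card + 1) * zeroSumBound (Fintype.card J) := by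
        rw [add_mul, one_mul]; exact add_le_add hyc hzc
      _ ≤ _ := Nat.mul_le_mul_right _ h1
  · rw [Finset.sum_union hdisj, hy0, hz0, add_zero]

end ZeroSum

/-! ### Greedy colourings and choices -/

section Selection

theorem exists_proper_coloring {A : Type*} [Finite A] (H : A → A → Prop)
    (hsymm : ∀ a b, H a b → H b a) (hirr : ∀ a, ¬ H a a) (d : ℕ)
    (hd : ∀ a, {b | H a b}.ncard ≤ d) :
    ∃ c : A → Fin (d + 1), ∀ a b, H a b → c a ≠ c b := by
  classical
  have := Fintype.ofFinite A
  suffices ∀ s : Finset A, ∃ c : A → Fin (d + 1), ∀ a ∈ s, ∀ b ∈ s, H a b → c a ≠ c b by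
    obtain ⟨c, hc⟩ := this Finset.univ
    exact ⟨c, fun a b => hc a (Finset.mem_univ _) b (Finset.mem_univ _)⟩
  intro s
  induction s using Finset.induction_on with
  | empty => exact ⟨fun _ => 0, by simp⟩
  | insert x s hx ih =>
    obtain ⟨c, hc⟩ := ih
    have hlt : ((Finset.univ.filter (H x)).image c).card <
        (Finset.univ : Finset (Fin (d + 1))).card := by
      refine Finset.card_image_le.trans_lt ?_
      rw [Finset.card_univ, Fintype.card_fin, Nat.lt_succ_iff]
      convert hd x
      rw [← Set.ncard_coe_finset]
      simp
    obtain ⟨k, -, hk⟩ := Finset.exists_mem_notMem_of_card_lt_card hlt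
    have hk' : ∀ b, H x b → c b ≠ k := fun b hb h =>
      hk (Finset.mem_image.2 ⟨b, by simpa using hb, h⟩)
    refine ⟨Function.update c x k, fun a ha b hb hab => ?_⟩
    by_cases hax : a = x
    · subst hax
      have hba : b ≠ a := fun h => hirr a (h ▸ hab)
      rw [Function.update_self, Function.update_of_ne hba]
      exact (hk' b hab).symm
    · by_cases hbx : b = x
      · subst hbx
        rw [Function.update_self, Function.update_of_ne hax]
        exact hk' a (hsymm _ _ hab)
      · rw [Function.update_of_ne hax, Function.update_of_ne hbx]
        exact hc a (Finset.mem_of_mem_insert_of_ne ha hax) b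
          (Finset.mem_of_mem_insert_of_ne hb hbx) hab

/-- The groups serve as a cyclic orientation: if unanswered messages always go from group `i` to
group `i + 1` modulo 3, no two of them can run between the same two elements in opposite directions.
-/
theorem exists_three_groups {A L : Type*} [DecidableEq L] (κ : A → L) (s : Finset A) (m : ℕ) :
    ∃ g : A → Fin 3, ∀ l, 3 * m ≤ (s.filter fun b => κ b = l).card →
      ∀ i, m ≤ (s.filter fun b => κ b = l ∧ g b = i).card := by
  classical
  have key : ∀ l, ∃ g : A → Fin 3, 3 * m ≤ (s.filter fun b => κ b = l).card →
      ∀ i, m ≤ (s.filter fun b => κ b = l ∧ g b = i).card := by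
    intro l
    by_cases h : 3 * m ≤ (s.filter fun b => κ b = l).card
    swap
    · exact ⟨fun _ => 0, fun h' => absurd h' h⟩
    obtain ⟨u, hu, huc⟩ := Finset.exists_subset_card_eq
      (show m ≤ (s.filter fun b => κ b = l).card by omega)
    have h1 := Finset.card_sdiff_of_subset hu
    obtain ⟨w, hw, hwc⟩ := Finset.exists_subset_card_eq
      (show m ≤ ((s.filter fun b => κ b = l) \ u).card by omega)
    have h2 := Finset.card_sdiff_of_subset hw
    refine ⟨fun b => if b ∈ u then 0 else if b ∈ w then 1 else 2, fun _ i => ?_⟩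
    fin_cases i
    · rw [← huc]
      refine Finset.card_le_card fun b hb => ?_
      have := Finset.mem_filter.1 (hu hb)
      simp [this, hb]
    · rw [← hwc]
      refine Finset.card_le_card fun b hb => ?_
      have h3 := Finset.mem_sdiff.1 (hw hb)
      have := Finset.mem_filter.1 h3.1
      simp [this, hb, h3.2]
    · refine le_trans (show m ≤ (((s.filter fun b => κ b = l) \ u) \ w).card by omega)
        (Finset.card_le_card fun b hb => ?_)
      simp only [Finset.mem_sdiff, Finset.mem_filter] at hb
      simp [hb]
  choose g hg using key
  refine ⟨fun b => g (κ b) b, fun l hl i => (hg l hl i).trans (Finset.card_le_card fun b hb => ?_)⟩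
  obtain ⟨h1, h2, h3⟩ := Finset.mem_filter.1 hb
  exact Finset.mem_filter.2 ⟨h1, h2, by simpa only [h2] using h3⟩

theorem exists_injOn_choice {α β : Type*} [Nonempty β] (s : Finset α) (C : α → Finset β)
    (h : ∀ a ∈ s, s.card ≤ (C a).card) :
    ∃ f : α → β, Set.InjOn f s ∧ ∀ a ∈ s, f a ∈ C a := by
  classical
  induction s using Finset.induction_on with
  | empty => exact ⟨fun _ => Classical.arbitrary β, by simp⟩
  | insert x s hx ih =>
    rw [Finset.card_insert_of_notMem hx] at h
    obtain ⟨f, hf, hfC⟩ := ih fun a ha =>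
      (Nat.le_succ _).trans (h a (Finset.mem_insert_of_mem ha))
    obtain ⟨y, hy, hy'⟩ := Finset.exists_mem_notMem_of_card_lt_card
      (Finset.card_image_le.trans_lt (h x (Finset.mem_insert_self _ _)) : (s.image f).card < _)
    have hne : ∀ a ∈ s, Function.update f x y a = f a := fun a ha =>
      Function.update_of_ne (by rintro rfl; exact hx ha) _ _
    have hym : ∀ a ∈ s, f a ≠ y := fun a ha h => hy' (Finset.mem_image.2 ⟨a, ha, h⟩)
    refine ⟨Function.update f x y, fun a ha b hb hab => ?_, fun a ha => ?_⟩
    · rcases Finset.mem_insert.1 (Finset.mem_coe.1 ha) with rfl | has <;>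
        rcases Finset.mem_insert.1 (Finset.mem_coe.1 hb) with rfl | hbs
      · rfl
      · rw [Function.update_self, hne b hbs] at hab
        exact absurd hab.symm (hym b hbs)
      · rw [Function.update_self, hne a has] at hab
        exact absurd hab (hym a has)
      · rw [hne a has, hne b hbs] at hab
        exact hf has hbs hab
    · rcases Finset.mem_insert.1 ha with rfl | ha
      · rwa [Function.update_self]
      · rw [hne a ha]; exact hfC a ha

theorem exists_inverse_pair_of_card_eq {α : Type*} {s t : Finset α} (h : s.card = t.card) :
    ∃ f f' : α → α, (∀ a ∈ s, f a ∈ t ∧ f' (f a) = a) ∧ ∀ b ∈ t, f' b ∈ s ∧ f (f' b) = b := by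
  classical
  let e := Finset.equivOfCardEq h
  refine ⟨fun a => if h : a ∈ s then e ⟨a, h⟩ else a,
    fun b => if h : b ∈ t then e.symm ⟨b, h⟩ else b, fun a ha => ?_, fun b hb => ?_⟩
  · simp [ha]
  · simp [hb]

end Selection

/-! ### Reconnecting labelled edges in a balanced subset -/

section Rewire

variable {A Λ L : Type*} [LinearOrder A] (U : Finset A) (E : A → A → Prop)
  (lab : A → A → Λ)

open Classical in
/-- The elements of `U` from which there is an ascending edge with label `τ`. -/
noncomputable def ascSource (τ : Λ) : Finset A :=
  U.filter fun a => ∃ b ∈ U, a < b ∧ E a b ∧ lab a b = τ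

open Classical in
/-- The elements of `U` to which there is an ascending edge with label `τ`. -/
noncomputable def ascTarget (τ : Λ) : Finset A :=
  U.filter fun b => ∃ a ∈ U, a < b ∧ E a b ∧ lab a b = τ

open Classical in
/-- The vector that has an entry for every label, and records the edges of an element. -/
noncomputable def edgeVector (a : A) (τ : Λ) : ℤ :=
  (if a ∈ ascSource U E lab τ then 1 else 0) - (if a ∈ ascTarget U E lab τ then 1 else 0)

theorem abs_edgeVector_le (a : A) (τ : Λ) : |edgeVector U E lab a τ| ≤ 1 := by
  unfold edgeVector
  split_ifs <;> simp

theorem sum_edgeVector (s : Finset A) (τ : Λ) :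
    ∑ a ∈ s, edgeVector U E lab a τ =
      ((s ∩ ascSource U E lab τ).card : ℤ) - ((s ∩ ascTarget U E lab τ).card : ℤ) := by
  unfold edgeVector
  rw [Finset.sum_sub_distrib]
  congr 1 <;>
  · rw [← Finset.filter_mem_eq_inter, Finset.card_filter]
    push_cast
    exact Finset.sum_congr rfl fun _ _ => by congr

variable {U E lab} {κ : A → L}

/-- The label fixes the classes of both ends, and an element has at most one neighbour in each
class. Hence the ascending edges with label `τ` match sources with targets bijectively. -/
theorem card_ascSource_eq (hsymm : ∀ a b, E a b → E b a)
    (hchrom : ∀ a b b', E a b → E a b' → κ b = κ b' → b = b')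
    (hlab : ∀ a b a' b', lab a b = lab a' b' → κ a = κ a' ∧ κ b = κ b')
    (τ : Λ) :
    (ascSource U E lab τ).card = (ascTarget U E lab τ).card := by
  classical
  apply le_antisymm
  · refine Finset.card_le_card_of_forall_subsingleton
      (fun a b => a < b ∧ E a b ∧ lab a b = τ) (fun a ha => ?_) fun b _ a ha a' ha' => ?_
    · obtain ⟨haU, b, hbU, h⟩ := Finset.mem_filter.1 ha
      exact ⟨b, Finset.mem_filter.2 ⟨hbU, a, haU, h⟩, h⟩
    · exact hchrom b a a' (hsymm _ _ ha.2.2.1) (hsymm _ _ ha'.2.2.1)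
        (hlab _ _ _ _ (ha.2.2.2.trans ha'.2.2.2.symm)).1
  · refine Finset.card_le_card_of_forall_subsingleton
      (fun b a => a < b ∧ E a b ∧ lab a b = τ) (fun b hb => ?_) fun a _ b hb b' hb' => ?_
    · obtain ⟨hbU, a, haU, h⟩ := Finset.mem_filter.1 hb
      exact ⟨a, Finset.mem_filter.2 ⟨haU, b, hbU, h⟩, h⟩
    · exact hchrom a b b' hb.2.2.1 hb'.2.2.1
        (hlab _ _ _ _ (hb.2.2.2.trans hb'.2.2.2.symm)).2

theorem sum_edgeVector_self (hsymm : ∀ a b, E a b → E b a)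
    (hchrom : ∀ a b b', E a b → E a b' → κ b = κ b' → b = b')
    (hlab : ∀ a b a' b', lab a b = lab a' b' → κ a = κ a' ∧ κ b = κ b')
    (τ : Λ) : ∑ a ∈ U, edgeVector U E lab a τ = 0 := by
  have h1 : U ∩ ascSource U E lab τ = ascSource U E lab τ :=
    Finset.inter_eq_right.2 (by classical exact Finset.filter_subset _ _)
  have h2 : U ∩ ascTarget U E lab τ = ascTarget U E lab τ :=
    Finset.inter_eq_right.2 (by classical exact Finset.filter_subset _ _)
  rw [sum_edgeVector, h1, h2, card_ascSource_eq hsymm hchrom hlab, sub_self]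

/-- In a subset on which the edge vectors sum to zero, the edges can be reconnected. -/
theorem exists_rewiring (hsymm : ∀ a b, E a b → E b a)
    (hlab : ∀ a b a' b', lab a b = lab a' b' → κ a = κ a' ∧ κ b = κ b')
    (hirr : ∀ a, ¬ E a a) {U' : Finset A} (hU : U' ⊆ U)
    (h0 : ∀ τ, ∑ a ∈ U', edgeVector U E lab a τ = 0) :
    ∃ ν : A → A → A, ∀ a ∈ U', ∀ b ∈ U, E a b →
      ν a b ∈ U' ∧ κ (ν a b) = κ b ∧
      ∃ b' ∈ U, E (ν a b) b' ∧ ν (ν a b) b' = a ∧ κ b' = κ a ∧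
        (lab b' (ν a b) = lab a b ∨ lab (ν a b) b' = lab b a) := by
  classical
  have hc : ∀ τ, (U' ∩ ascSource U E lab τ).card = (U' ∩ ascTarget U E lab τ).card := fun τ => by
    have := h0 τ
    rw [sum_edgeVector] at this
    omega
  choose f f' hf hf' using fun τ => exists_inverse_pair_of_card_eq (hc τ)
  -- An ascending edge follows the bijection from sources to targets of its label inside `U'`, a
  -- descending edge the inverse bijection, so each new edge is seen consistently from both ends.
  refine ⟨fun a b => if a < b then f (lab a b) a else f' (lab b a) a, fun a ha b hb hab => ?_⟩
  rcases lt_trichotomy a b with hlt | rfl | hlt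
  · simp only [if_pos hlt]
    obtain ⟨h1, h2⟩ := hf (lab a b) a (Finset.mem_inter.2 ⟨ha, Finset.mem_filter.2
      ⟨hU ha, b, hb, hlt, hab, rfl⟩⟩)
    set x := f (lab a b) a
    obtain ⟨hx, hx'⟩ := Finset.mem_inter.1 h1
    obtain ⟨-, b', hb', hlt', hE, hl⟩ := Finset.mem_filter.1 hx'
    refine ⟨hx, (hlab _ _ _ _ hl).2, b', hb', hsymm _ _ hE, ?_, (hlab _ _ _ _ hl).1, Or.inl hl⟩
    rw [if_neg hlt'.not_gt, hl, h2]
  · exact absurd hab (hirr a)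
  · simp only [if_neg hlt.not_gt]
    obtain ⟨h1, h2⟩ := hf' (lab b a) a (Finset.mem_inter.2 ⟨ha, Finset.mem_filter.2
      ⟨hU ha, b, hb, hlt, hsymm _ _ hab, rfl⟩⟩)
    set x := f' (lab b a) a
    obtain ⟨hx, hx'⟩ := Finset.mem_inter.1 h1
    obtain ⟨-, b', hb', hlt', hE, hl⟩ := Finset.mem_filter.1 hx'
    refine ⟨hx, (hlab _ _ _ _ hl).1, b', hb', hE, ?_, (hlab _ _ _ _ hl).2, Or.inr hl⟩
    rw [if_pos hlt', hl, h2]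

end Rewire

/-! ### Messages and their redirection -/

section Messages

variable {A T L : Type*} (t : A → A → T) (μ : T → Prop)

/-- `a` and `b` send messages to each other. -/
def MutualMessage (a b : A) : Prop := a ≠ b ∧ μ (t a b) ∧ μ (t b a)

open Classical in
/-- The elements of `U` to which `a` sends a message. -/
noncomputable def receivers (U : Finset A) (a : A) : Finset A :=
  U.filter fun b => b ≠ a ∧ μ (t a b)

variable {t μ}

theorem MutualMessage.symm {a b : A} (h : MutualMessage t μ a b) : MutualMessage t μ b a :=
  ⟨h.1.symm, h.2.2, h.2.1⟩

theorem mem_receivers {U : Finset A} {a b : A} :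
    b ∈ receivers t μ U a ↔ b ∈ U ∧ b ≠ a ∧ μ (t a b) := by
  classical
  exact Finset.mem_filter

theorem receivers_mono {U U' : Finset A} (h : U ⊆ U') (a : A) :
    receivers t μ U a ⊆ receivers t μ U' a := fun b hb => by
  rw [mem_receivers] at hb ⊢
  exact ⟨h hb.1, hb.2⟩

/-- A greedy colouring of the graph that joins elements at distance one or two along mutual
messages; its degrees are at most `D + D * D`. -/
theorem exists_chromatic_coloring [Fintype A] {D : ℕ}
    (hD : ∀ a, (receivers t μ Finset.univ a).card ≤ D) :
    ∃ c : A → Fin (D + D * D + 1),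
      (∀ a b, MutualMessage t μ a b → c a ≠ c b) ∧
      ∀ a b b', MutualMessage t μ a b → MutualMessage t μ a b' → c b = c b' → b = b' := by
  classical
  let H : A → A → Prop := fun a b => a ≠ b ∧
    (MutualMessage t μ a b ∨ ∃ x, MutualMessage t μ a x ∧ MutualMessage t μ x b)
  obtain ⟨c, hc⟩ := exists_proper_coloring H
    (by
      rintro a b ⟨hne, h | ⟨x, h1, h2⟩⟩
      · exact ⟨hne.symm, Or.inl h.symm⟩
      · exact ⟨hne.symm, Or.inr ⟨x, h2.symm, h1.symm⟩⟩)
    (fun a h => h.1 rfl) (D + D * D) (fun a => by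
      have hsub : {b | H a b} ⊆ ((receivers t μ Finset.univ a ∪
          (receivers t μ Finset.univ a).biUnion (receivers t μ Finset.univ) : Finset A) : Set A) := by
        rintro b ⟨hne, h | ⟨x, h1, h2⟩⟩
        · exact Finset.mem_coe.2 (Finset.mem_union_left _
            (mem_receivers.2 ⟨Finset.mem_univ _, h.1.symm, h.2.1⟩))
        · exact Finset.mem_coe.2 (Finset.mem_union_right _ (Finset.mem_biUnion.2
            ⟨x, mem_receivers.2 ⟨Finset.mem_univ _, h1.1.symm, h1.2.1⟩,
              mem_receivers.2 ⟨Finset.mem_univ _, h2.1.symm, h2.2.1⟩⟩))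
      refine (Set.ncard_le_ncard hsub (Finset.finite_toSet _)).trans ?_
      rw [Set.ncard_coe_finset]
      refine (Finset.card_union_le _ _).trans (add_le_add (hD a) ?_)
      exact (Finset.card_biUnion_le_card_mul _ _ D fun x _ => hD x).trans
        (Nat.mul_le_mul_right _ (hD a)))
  refine ⟨c, fun a b h => hc a b ⟨h.1, Or.inl h⟩, fun a b b' h h' hcb => ?_⟩
  by_contra hne
  exact hc b b' ⟨hne, Or.inr ⟨a, h.symm, h'⟩⟩ hcb

/-- Between two large classes there is a pair that sends no messages. -/
theorem exists_silent_pair [Fintype A] {D : ℕ}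
    (hD : ∀ a, (receivers t μ Finset.univ a).card ≤ D) {X Y : Finset A}
    (hX : 2 * D + 2 ≤ X.card) (hY : 2 * D + 2 ≤ Y.card) :
    ∃ a ∈ X, ∃ b ∈ Y, a ≠ b ∧ ¬ μ (t a b) ∧ ¬ μ (t b a) := by
  classical
  obtain ⟨X', hX', hXc⟩ := Finset.exists_subset_card_eq hX
  obtain ⟨Y', hY', hYc⟩ := Finset.exists_subset_card_eq hY
  by_contra! hcon
  -- With `N = 2 * D + 2` elements on each side, at most `N * (D + 1)` pairs are diagonal or carry a
  -- message forwards and at most `N * D` carry one backwards, fewer than `N * N` in all.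
  have hsub : X' ×ˢ Y' ⊆
      X'.biUnion (fun a => (insert a (receivers t μ Finset.univ a)).image fun b => (a, b)) ∪
      Y'.biUnion (fun b => (receivers t μ Finset.univ b).image fun a => (a, b)) := by
    rintro ⟨a, b⟩ hab
    obtain ⟨ha, hb⟩ := Finset.mem_product.1 hab
    simp only [Finset.mem_union, Finset.mem_biUnion, Finset.mem_image, Finset.mem_insert,
      mem_receivers, Finset.mem_univ, true_and, Prod.mk.injEq]
    by_cases hne : a = b
    · exact Or.inl ⟨a, ha, b, Or.inl hne.symm, rfl, rfl⟩
    by_cases hm : μ (t a b)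
    · exact Or.inl ⟨a, ha, b, Or.inr ⟨Ne.symm hne, hm⟩, rfl, rfl⟩
    · exact Or.inr ⟨b, hb, a, ⟨hne, hcon a (hX' ha) b (hY' hb) hne hm⟩, rfl, rfl⟩
  have h1 := (Finset.card_le_card hsub).trans (Finset.card_union_le _ _)
  have h2 := Finset.card_biUnion_le_card_mul X'
    (fun a => (insert a (receivers t μ Finset.univ a)).image fun b => (a, b)) (D + 1)
    fun a _ => Finset.card_image_le.trans ((Finset.card_insert_le _ _).trans
      (Nat.add_le_add_right (hD a) 1))
  have h3 := Finset.card_biUnion_le_card_mul Y'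
    (fun b => (receivers t μ Finset.univ b).image fun a => (a, b)) D
    fun a _ => Finset.card_image_le.trans (hD a)
  rw [Finset.card_product] at h1
  rw [hXc] at h1 h2
  rw [hYc] at h1 h3
  nlinarith

variable {κ : A → L}

/-- If classes are large, then messages among the elements of `U` can be redirected to elements of
a subset in which the mutual messages balance. -/
theorem exists_redirection [Fintype A] [LinearOrder A] {D : ℕ}
    (hD : ∀ a, (receivers t μ Finset.univ a).card ≤ D)
    (hne : ∀ a b, MutualMessage t μ a b → κ a ≠ κ b)
    (hchrom : ∀ a b b', MutualMessage t μ a b → MutualMessage t μ a b' → κ b = κ b' → b = b')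
    {U U' : Finset A} (hU : U' ⊆ U)
    (h0 : ∀ τ : T × T × L × L, ∑ a ∈ U', edgeVector U (MutualMessage t μ)
      (fun a b => (t a b, t b a, κ a, κ b)) a τ = 0)
    (hlarge : ∀ b ∈ U, ∃ s ⊆ U', 6 * D ≤ s.card ∧ ∀ x ∈ s, κ x = κ b) :
    ∃ ρ : A → A → A, ∀ a ∈ U',
      (∀ b ∈ receivers t μ U a, ρ a b ∈ U' ∧ ρ a b ≠ a ∧ κ (ρ a b) = κ b) ∧
      Set.InjOn (ρ a) (receivers t μ U a) ∧
      (∀ b₀ ∈ receivers t μ U a, ∀ a₀ ∈ receivers t μ U (ρ a b₀), ρ (ρ a b₀) a₀ = a →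
        t (ρ a b₀) a₀ = t b₀ a ∧ t a₀ (ρ a b₀) = t a b₀) ∧
      ∀ b₀ ∈ receivers t μ U a,
        (∀ a₀ ∈ receivers t μ U (ρ a b₀), ρ (ρ a b₀) a₀ ≠ a) → ¬ μ (t b₀ a) := by
  classical
  obtain ⟨ν, hν⟩ := exists_rewiring (κ := κ) (fun _ _ h => h.symm)
    (fun a b a' b' h => by
      simp only [Prod.mk.injEq] at h
      exact ⟨h.2.2.1, h.2.2.2⟩) (fun a h => h.1 rfl) hU h0
  -- Each group needs `2 * D` elements of a class: up to `D` are blocked as images under `ν`, and up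
  -- to `D` unanswered messages need distinct receivers.
  obtain ⟨g, hg⟩ := exists_three_groups κ U' (2 * D)
  have hrest : ∀ a, ∃ f : A → A,
      Set.InjOn f ((receivers t μ U a).filter fun b => ¬ μ (t b a)) ∧
      ∀ b ∈ (receivers t μ U a).filter fun b => ¬ μ (t b a),
        f b ∈ (U'.filter fun x => κ x = κ b ∧ g x = g a + 1) \
          ((receivers t μ U a).image (ν a)) := by
    intro a
    have : Nonempty A := ⟨a⟩
    refine exists_injOn_choice _ (fun b => (U'.filter fun x => κ x = κ b ∧ g x = g a + 1) \
          ((receivers t μ U a).image (ν a))) fun b hb => ?_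
    have hr : (receivers t μ U a).card ≤ D :=
      (Finset.card_le_card (receivers_mono (Finset.subset_univ _) a)).trans (hD a)
    obtain ⟨s, hs, hsc, hsκ⟩ := hlarge b (mem_receivers.1 (Finset.mem_filter.1 hb).1).1
    have h1 := hg (κ b) (by
      refine le_trans (by omega) (hsc.trans (Finset.card_le_card fun x hx => ?_))
      exact Finset.mem_filter.2 ⟨hs hx, hsκ x hx⟩) (g a + 1)
    have h2 := Finset.le_card_sdiff ((receivers t μ U a).image (ν a))
      (U'.filter fun x => κ x = κ b ∧ g x = g a + 1)
    have h3 : ((receivers t μ U a).image (ν a)).card ≤ _ := Finset.card_image_le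
    have h4 := Finset.card_filter_le (receivers t μ U a) fun b => ¬ μ (t b a)
    omega
  choose f hfinj hf using hrest
  have hE : ∀ {a b}, b ∈ receivers t μ U a → μ (t b a) → MutualMessage t μ a b :=
    fun {a b} hb hm => ⟨(mem_receivers.1 hb).2.1.symm, (mem_receivers.1 hb).2.2, hm⟩
  have hErec : ∀ {a b}, b ∈ U → MutualMessage t μ a b → b ∈ receivers t μ U a :=
    fun {a b} hb h => mem_receivers.2 ⟨hb, h.1.symm, h.2.1⟩
  have hf' : ∀ a, ∀ b ∈ receivers t μ U a, ¬ μ (t b a) → f a b ∈ U' ∧ κ (f a b) = κ b ∧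
      g (f a b) = g a + 1 ∧ ∀ b' ∈ receivers t μ U a, ν a b' ≠ f a b := by
    intro a b hb hm
    have h := hf a b (Finset.mem_filter.2 ⟨hb, hm⟩)
    obtain ⟨h1, h2⟩ := Finset.mem_sdiff.1 h
    obtain ⟨h3, h4, h5⟩ := Finset.mem_filter.1 h1
    exact ⟨h3, h4, h5, fun b' hb' he => h2 (Finset.mem_image.2 ⟨b', hb', he⟩)⟩
  have hg1 : ∀ i : Fin 3, i ≠ i + 1 := by decide
  have hg2 : ∀ i j : Fin 3, i = j + 1 → j ≠ i + 1 := by decide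
  -- Mutual messages follow the rewiring `ν`; unanswered ones follow `f` into the next group.
  refine ⟨fun a b => if μ (t b a) then ν a b else f a b, fun a ha => ⟨?_, ?_, ?_, ?_⟩⟩
  · intro b hb
    have hbU := (mem_receivers.1 hb).1
    by_cases hm : μ (t b a)
    · simp only [if_pos hm]
      obtain ⟨h1, h2, -⟩ := hν a ha b hbU (hE hb hm)
      refine ⟨h1, fun h => ?_, h2⟩
      rw [h] at h2
      exact hne a b (hE hb hm) h2
    · simp only [if_neg hm]
      obtain ⟨h1, h2, h3, -⟩ := hf' a b hb hm
      exact ⟨h1, fun h => hg1 (g a) (by rw [h] at h3; exact h3), h2⟩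
  · intro b hb b' hb' heq
    rw [Finset.mem_coe] at hb hb'
    by_cases hm : μ (t b a) <;> by_cases hm' : μ (t b' a) <;>
      simp only [hm, hm', if_true, if_false] at heq
    · have h1 := (hν a ha b (mem_receivers.1 hb).1 (hE hb hm)).2.1
      have h2 := (hν a ha b' (mem_receivers.1 hb').1 (hE hb' hm')).2.1
      exact hchrom a b b' (hE hb hm) (hE hb' hm') (by rw [← h1, ← h2, heq])
    · exact absurd heq ((hf' a b' hb' hm').2.2.2 b hb)
    · exact absurd heq.symm ((hf' a b hb hm).2.2.2 b' hb')
    · exact hfinj a (by simpa using ⟨hb, hm⟩) (by simpa using ⟨hb', hm'⟩) heq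
  · intro b₀ hb₀ a₀ ha₀ heq
    by_cases hm : μ (t b₀ a)
    · simp only [if_pos hm] at ha₀ heq ⊢
      obtain ⟨h1, h2, b', hb', hEb, hback, hκ, hl⟩ :=
        hν a ha b₀ (mem_receivers.1 hb₀).1 (hE hb₀ hm)
      have hb'r := hErec hb' hEb
      by_cases hm' : μ (t a₀ (ν a b₀))
      · simp only [if_pos hm'] at heq
        have h3 := (hν _ h1 a₀ (mem_receivers.1 ha₀).1 (hE ha₀ hm')).2.1
        have h4 : a₀ = b' := hchrom _ _ _ (hE ha₀ hm') hEb (by rw [← h3, heq, hκ])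
        subst h4
        simp only [Prod.mk.injEq] at hl
        rcases hl with hl | hl
        · exact ⟨hl.2.1, hl.1⟩
        · exact ⟨hl.1, hl.2.1⟩
      · simp only [if_neg hm'] at heq
        exact absurd (hback.trans heq.symm) ((hf' _ a₀ ha₀ hm').2.2.2 b' hb'r)
    · simp only [if_neg hm] at ha₀ heq ⊢
      obtain ⟨h1, h2, h3, h4⟩ := hf' a b₀ hb₀ hm
      by_cases hm' : μ (t a₀ (f a b₀))
      · simp only [if_pos hm'] at heq
        obtain ⟨-, -, b', hb', hEb, hback, -⟩ :=
          hν _ h1 a₀ (mem_receivers.1 ha₀).1 (hE ha₀ hm')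
        rw [heq] at hEb hback
        exact absurd hback (h4 b' (hErec hb' hEb))
      · simp only [if_neg hm'] at heq
        have h5 := (hf' _ a₀ ha₀ hm').2.2.1
        rw [heq] at h5
        exact absurd h3 (fun h3 => hg2 _ _ h3 h5)
  · intro b₀ hb₀ hno hm
    simp only [if_pos hm] at hno
    obtain ⟨h1, h2, b', hb', hEb, hback, -⟩ :=
      hν a ha b₀ (mem_receivers.1 hb₀).1 (hE hb₀ hm)
    refine hno b' (hErec hb' hEb) ?_
    rw [if_pos hEb.2.2, hback]

end Messages

/-! ### Cutting a structure down to few elements -/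

section Surgery

variable {A T L : Type*} {t : A → A → T} {μ : T → Prop} {κ : A → L}

/-- All elements `K` of small classes are kept, with every pair that meets `K` unchanged. From the
rest `U`, a balanced subset `U'` is kept, inside which messages are redirected. Pairs in `U'`
without a redirected message copy a silent pair between their classes. -/
theorem exists_small_restructuring_of_chromatic [Fintype A] [LinearOrder A] [Fintype T]
    [Fintype L] [DecidableEq T] {D : ℕ}
    (hD : ∀ a, (receivers t μ Finset.univ a).card ≤ D)
    (hne : ∀ a b, MutualMessage t μ a b → κ a ≠ κ b)
    (hchrom : ∀ a b b', MutualMessage t μ a b → MutualMessage t μ a b' → κ b = κ b' → b = b')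
    (c : Finset A) :
    ∃ (B : Finset A) (t' : A → A → T), c ⊆ B ∧
      B.card ≤ Fintype.card L * (6 * D + 2) + (c.card + Fintype.card L * (6 * D + 2) * D +
        Fintype.card L * (6 * D + 2)) * zeroSumBound (Fintype.card (T × T × L × L)) ∧
      (∀ a, t' a a = t a a) ∧
      (∀ a ∈ B, ∀ b ∈ B, a ≠ b → ∃ a₀ b₀, a₀ ≠ b₀ ∧ κ a₀ = κ a ∧ κ b₀ = κ b ∧
        t' a b = t a₀ b₀ ∧ t' b a = t b₀ a₀) ∧
      ∀ a ∈ B, ∀ τ, μ τ → (B.filter fun b => b ≠ a ∧ t' a b = τ).card =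
        (Finset.univ.filter fun b => b ≠ a ∧ t a b = τ).card := by
  classical
  -- Redirection needs classes with `6 * D` elements, silent pairs need `2 * D + 2`.
  set Θ := 6 * D + 2 with hΘ
  let cls : L → Finset A := fun l => Finset.univ.filter fun b => κ b = l
  have hP : ∀ l, ∃ P ⊆ cls l, P.card ≤ Θ ∧ (Θ ≤ (cls l).card → P.card = Θ) := by
    intro l
    by_cases h : Θ ≤ (cls l).card
    · obtain ⟨P, hP, hPc⟩ := Finset.exists_subset_card_eq h
      exact ⟨P, hP, hPc.le, fun _ => hPc⟩
    · exact ⟨∅, by simp, by simp, fun h' => absurd h' h⟩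
  choose P hPcls hPle hPeq using hP
  let U : Finset A := Finset.univ.filter fun a => Θ ≤ (cls (κ a)).card
  have hU : ∀ {a}, a ∈ U ↔ Θ ≤ (cls (κ a)).card := fun {a} => by simp [U]
  let K : Finset A := Uᶜ
  have hK : K.card ≤ Fintype.card L * Θ := by
    rw [mul_comm, ← Finset.card_univ]
    refine Finset.card_le_mul_card_image_of_maps_to (f := κ) (fun _ _ => Finset.mem_univ _) _
      fun l _ => ?_
    by_cases h : Θ ≤ (cls l).card
    · rw [Finset.filter_eq_empty_iff.2]
      · simp
      · rintro a ha rfl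
        exact (Finset.mem_compl.1 ha) (hU.2 h)
    · exact (Finset.card_le_card fun a ha =>
        Finset.mem_filter.2 ⟨Finset.mem_univ a, (Finset.mem_filter.1 ha).2⟩).trans (not_le.1 h).le
  -- The set to be retained from `U`: the prescribed elements, everything to which `K` sends a
  -- message, and `Θ` representatives of each large class.
  let B₀ : Finset A := (c ∪ K.biUnion (receivers t μ Finset.univ) ∪ Finset.univ.biUnion P) ∩ U
  have hB₀ : B₀.card ≤ c.card + Fintype.card L * Θ * D + Fintype.card L * Θ := by
    refine (Finset.card_le_card Finset.inter_subset_left).trans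
      ((Finset.card_union_le _ _).trans (add_le_add ((Finset.card_union_le _ _).trans
        (add_le_add le_rfl ?_)) ?_))
    · exact (Finset.card_biUnion_le_card_mul _ _ D fun a _ => hD a).trans
        (Nat.mul_le_mul_right _ hK)
    · exact Finset.card_biUnion_le_card_mul _ _ Θ fun l _ => hPle l
  obtain ⟨U', hBU', hU'U, hU'c, hU'0⟩ := exists_zeroSum_superset
    (abs_edgeVector_le U (MutualMessage t μ) fun a b => (t a b, t b a, κ a, κ b))
    (Finset.inter_subset_right : B₀ ⊆ U)
    (sum_edgeVector_self (κ := κ) (fun _ _ h => h.symm) hchrom fun a b a' b' h => by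
      simp only [Prod.mk.injEq] at h
      exact ⟨h.2.2.1, h.2.2.2⟩)
  have hPU : ∀ {l}, Θ ≤ (cls l).card → P l ⊆ U' := by
    intro l hl x hx
    refine hBU' (Finset.mem_inter.2 ⟨Finset.mem_union_right _
      (Finset.mem_biUnion.2 ⟨l, Finset.mem_univ _, hx⟩), hU.2 ?_⟩)
    rw [(Finset.mem_filter.1 (hPcls l hx)).2]
    exact hl
  obtain ⟨ρ, hρ⟩ := exists_redirection hD hne hchrom hU'U hU'0 fun b hb =>
    ⟨P (κ b), hPU (hU.1 hb), by rw [hPeq _ (hU.1 hb)]; omega,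
      fun x hx => (Finset.mem_filter.1 (hPcls _ hx)).2⟩
  have hsil : ∀ a b, ∃ a₀ b₀, a ∈ U → b ∈ U → a₀ ≠ b₀ ∧ κ a₀ = κ a ∧ κ b₀ = κ b ∧
      ¬ μ (t a₀ b₀) ∧ ¬ μ (t b₀ a₀) := by
    intro a b
    by_cases h : a ∈ U ∧ b ∈ U
    · obtain ⟨a₀, ha₀, b₀, hb₀, h1, h2, h3⟩ := exists_silent_pair hD
        (le_trans (by omega) (hU.1 h.1)) (le_trans (by omega) (hU.1 h.2))
      exact ⟨a₀, b₀, fun _ _ => ⟨h1, (Finset.mem_filter.1 ha₀).2, (Finset.mem_filter.1 hb₀).2,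
        h2, h3⟩⟩
    · exact ⟨a, a, fun ha hb => absurd ⟨ha, hb⟩ h⟩
  choose p₁ p₂ hp using hsil
  -- Both directions of a pair must copy the same old pair. If messages are redirected both ways,
  -- the two choices agree by the compatibility clause of `exists_redirection`; for silent pairs the
  -- order decides which choice is used.
  let t' : A → A → T := fun a b =>
    if a = b ∨ a ∉ U ∨ b ∉ U then t a b
    else if h : ∃ b₀ ∈ receivers t μ U a, ρ a b₀ = b then t a h.choose
    else if h : ∃ a₀ ∈ receivers t μ U b, ρ b a₀ = a then t h.choose b
    else if a < b then t (p₁ a b) (p₂ a b) else t (p₂ b a) (p₁ b a)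
  have ht'K : ∀ {a b}, a = b ∨ a ∉ U ∨ b ∉ U → t' a b = t a b := fun {a b} h => if_pos h
  have ht'1 : ∀ {a b₀}, a ∈ U' → b₀ ∈ receivers t μ U a → t' a (ρ a b₀) = t a b₀ := by
    intro a b₀ ha hb₀
    obtain ⟨h1, h2, -⟩ := (hρ a ha).1 b₀ hb₀
    have h : ∃ b ∈ receivers t μ U a, ρ a b = ρ a b₀ := ⟨b₀, hb₀, rfl⟩
    have h3 : ¬ (a = ρ a b₀ ∨ a ∉ U ∨ ρ a b₀ ∉ U) := by
      simp [h2.symm, hU'U ha, hU'U h1]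
    have h4 : h.choose = b₀ := (hρ a ha).2.1 h.choose_spec.1 hb₀ h.choose_spec.2
    simp only [t']
    rw [if_neg h3, dif_pos h, h4]
  have ht'2 : ∀ {a b₀}, a ∈ U' → b₀ ∈ receivers t μ U a → t' (ρ a b₀) a = t b₀ a := by
    intro a b₀ ha hb₀
    obtain ⟨h1, h2, -⟩ := (hρ a ha).1 b₀ hb₀
    by_cases h : ∃ a₀ ∈ receivers t μ U (ρ a b₀), ρ (ρ a b₀) a₀ = a
    · obtain ⟨a₀, ha₀, heq⟩ := h
      have h3 := ht'1 h1 ha₀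
      rw [heq] at h3
      rw [h3]
      exact ((hρ a ha).2.2.1 b₀ hb₀ a₀ ha₀ heq).1
    · have h' : ∃ b ∈ receivers t μ U a, ρ a b = ρ a b₀ := ⟨b₀, hb₀, rfl⟩
      have h3 : ¬ (ρ a b₀ = a ∨ ρ a b₀ ∉ U ∨ a ∉ U) := by
        simp [h2, hU'U ha, hU'U h1]
      have h4 : h'.choose = b₀ := (hρ a ha).2.1 h'.choose_spec.1 hb₀ h'.choose_spec.2
      simp only [t']
      rw [if_neg h3, dif_neg h, dif_pos h', h4]
  have ht'3 : ∀ {a b}, a ∈ U' → b ∈ U' → a ≠ b → (¬ ∃ b₀ ∈ receivers t μ U a, ρ a b₀ = b) →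
      (¬ ∃ a₀ ∈ receivers t μ U b, ρ b a₀ = a) →
      t' a b = if a < b then t (p₁ a b) (p₂ a b) else t (p₂ b a) (p₁ b a) := by
    intro a b ha hb hab h1 h2
    have h3 : ¬ (a = b ∨ a ∉ U ∨ b ∉ U) := by simp [hab, hU'U ha, hU'U hb]
    simp only [t']
    rw [if_neg h3, dif_neg h1, dif_neg h2]
  have hdisj : Disjoint K U' := by
    rw [Finset.disjoint_left]
    exact fun a ha ha' => (Finset.mem_compl.1 ha) (hU'U ha')
  have hmemB : ∀ {a}, a ∈ K ∪ U' → a ∈ U → a ∈ U' := fun {a} ha haU =>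
    (Finset.mem_union.1 ha).resolve_left fun h => Finset.mem_compl.1 h haU
  refine ⟨K ∪ U', t', ?_, ?_, fun a => ht'K (Or.inl rfl), ?_, ?_⟩
  · intro a ha
    by_cases haU : a ∈ U
    · exact Finset.mem_union_right _ (hBU' (Finset.mem_inter.2
        ⟨Finset.mem_union_left _ (Finset.mem_union_left _ ha), haU⟩))
    · exact Finset.mem_union_left _ (Finset.mem_compl.2 haU)
  · exact (Finset.card_union_le _ _).trans
      (add_le_add hK (hU'c.trans (Nat.mul_le_mul_right _ hB₀)))
  · intro a ha b hb hab
    by_cases haU : a ∈ U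
    swap
    · exact ⟨a, b, hab, rfl, rfl, ht'K (Or.inr (Or.inl haU)), ht'K (Or.inr (Or.inr haU))⟩
    by_cases hbU : b ∈ U
    swap
    · exact ⟨a, b, hab, rfl, rfl, ht'K (Or.inr (Or.inr hbU)), ht'K (Or.inr (Or.inl hbU))⟩
    replace ha := hmemB ha haU
    replace hb := hmemB hb hbU
    by_cases h1 : ∃ b₀ ∈ receivers t μ U a, ρ a b₀ = b
    · obtain ⟨b₀, hb₀, rfl⟩ := h1
      exact ⟨a, b₀, (mem_receivers.1 hb₀).2.1.symm, rfl, ((hρ a ha).1 b₀ hb₀).2.2.symm,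
        ht'1 ha hb₀, ht'2 ha hb₀⟩
    by_cases h2 : ∃ a₀ ∈ receivers t μ U b, ρ b a₀ = a
    · obtain ⟨a₀, ha₀, rfl⟩ := h2
      exact ⟨a₀, b, (mem_receivers.1 ha₀).2.1, ((hρ b hb).1 a₀ ha₀).2.2.symm, rfl,
        ht'2 hb ha₀, ht'1 hb ha₀⟩
    rw [ht'3 ha hb hab h1 h2, ht'3 hb ha hab.symm h2 h1]
    rcases lt_or_gt_of_ne hab with hlt | hlt
    · obtain ⟨h3, h4, h5, -⟩ := hp a b haU hbU
      rw [if_pos hlt, if_neg hlt.not_gt]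
      exact ⟨_, _, h3, h4, h5, rfl, rfl⟩
    · obtain ⟨h3, h4, h5, -⟩ := hp b a hbU haU
      rw [if_pos hlt, if_neg hlt.not_gt]
      exact ⟨_, _, h3.symm, h5, h4, rfl, rfl⟩
  · intro a ha τ hτ
    by_cases haU : a ∈ U
    · replace ha := hmemB ha haU
      have huniv : (Finset.univ : Finset A) = K ∪ U := by
        ext x
        simp [K, em']
      have hdisj' : Disjoint K U := disjoint_compl_left
      rw [huniv, Finset.filter_union, Finset.filter_union,
        Finset.card_union_of_disjoint (Finset.disjoint_filter_filter hdisj),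
        Finset.card_union_of_disjoint (Finset.disjoint_filter_filter hdisj')]
      congr 1
      · congr 1
        refine Finset.filter_congr fun b hb => ?_
        rw [ht'K (Or.inr (Or.inr (Finset.mem_compl.1 hb)))]
      · have himg : (U'.filter fun b => b ≠ a ∧ t' a b = τ) =
            (U.filter fun b => b ≠ a ∧ t a b = τ).image (ρ a) := by
          ext b
          simp only [Finset.mem_filter, Finset.mem_image]
          constructor
          · rintro ⟨hb, hba, heq⟩
            by_cases h1 : ∃ b₀ ∈ receivers t μ U a, ρ a b₀ = b
            · obtain ⟨b₀, hb₀, rfl⟩ := h1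
              rw [ht'1 ha hb₀] at heq
              have h := mem_receivers.1 hb₀
              exact ⟨b₀, ⟨h.1, h.2.1, heq⟩, rfl⟩
            exfalso
            by_cases h2 : ∃ a₀ ∈ receivers t μ U b, ρ b a₀ = a
            · obtain ⟨a₀, ha₀, rfl⟩ := h2
              rw [ht'2 hb ha₀] at heq
              exact (hρ b hb).2.2.2 a₀ ha₀ (fun b₀ hb₀ h => h1 ⟨b₀, hb₀, h⟩) (heq ▸ hτ)
            rw [ht'3 ha hb hba.symm h1 h2] at heq
            split_ifs at heq with hlt
            · exact (hp a b haU (hU'U hb)).2.2.2.1 (heq ▸ hτ)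
            · exact (hp b a (hU'U hb) haU).2.2.2.2 (heq ▸ hτ)
          · rintro ⟨b₀, ⟨hb₀U, hb₀a, heq⟩, rfl⟩
            have hr : b₀ ∈ receivers t μ U a := mem_receivers.2 ⟨hb₀U, hb₀a, heq ▸ hτ⟩
            have h := (hρ a ha).1 b₀ hr
            exact ⟨h.1, h.2.1, (ht'1 ha hr).trans heq⟩
        rw [himg, Finset.card_image_of_injOn]
        intro b hb b' hb' h
        obtain ⟨h1, h2, h3⟩ := Finset.mem_filter.1 (Finset.mem_coe.1 hb)
        obtain ⟨h1', h2', h3'⟩ := Finset.mem_filter.1 (Finset.mem_coe.1 hb')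
        exact (hρ a ha).2.1 (mem_receivers.2 ⟨h1, h2, h3 ▸ hτ⟩)
          (mem_receivers.2 ⟨h1', h2', h3' ▸ hτ⟩) h
    -- An element of `K` keeps its labels, and all its receivers lie in `B` because those in `U`
    -- were put into `B₀`.
    · congr 1
      ext b
      simp only [Finset.mem_filter, Finset.mem_univ, true_and, ht'K (Or.inr (Or.inl haU) :
        a = b ∨ a ∉ U ∨ b ∉ U), and_iff_right_iff_imp]
      rintro ⟨hba, heq⟩
      by_cases hbU : b ∈ U
      · refine Finset.mem_union_right _ (hBU' (Finset.mem_inter.2 ⟨Finset.mem_union_left _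
          (Finset.mem_union_right _ (Finset.mem_biUnion.2 ⟨a, Finset.mem_compl.2 haU, ?_⟩)), hbU⟩))
        exact mem_receivers.2 ⟨Finset.mem_univ _, hba, heq ▸ hτ⟩
      · exact Finset.mem_union_left _ (Finset.mem_compl.2 hbU)

/-- A bound on the number of elements to which a structure with `n` pair labels, in which every
element sends at most `D` messages, can be cut down. -/
def restructuringBound (n D : ℕ) : ℕ :=
  n * (D + D * D + 1) * (6 * D + 2) +
    (1 + n * (D + D * D + 1) * (6 * D + 2) * D + n * (D + D * D + 1) * (6 * D + 2)) *
      zeroSumBound (n * (n * ((n * (D + D * D + 1)) * (n * (D + D * D + 1)))))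

/-- From a finite set of elements with labelled pairs one can choose a small subset and relabel
its pairs so that every pair looks like one of the original pairs, and every element sends the
same messages as before. -/
theorem exists_small_restructuring [Finite A] [Fintype T] [DecidableEq T] {D : ℕ}
    (hD : ∀ a, {b | b ≠ a ∧ μ (t a b)}.ncard ≤ D) (x : A) :
    ∃ (B : Finset A) (t' : A → A → T), x ∈ B ∧
      B.card ≤ restructuringBound (Fintype.card T) D ∧
      (∀ a, t' a a = t a a) ∧
      (∀ a ∈ B, ∀ b ∈ B, a ≠ b → ∃ a₀ b₀, a₀ ≠ b₀ ∧ t a₀ a₀ = t a a ∧ t b₀ b₀ = t b b ∧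
        t' a b = t a₀ b₀ ∧ t' b a = t b₀ a₀) ∧
      ∀ a ∈ B, ∀ τ, μ τ →
        {b | b ∈ B ∧ b ≠ a ∧ t' a b = τ}.ncard = {b | b ≠ a ∧ t a b = τ}.ncard := by
  classical
  have := Fintype.ofFinite A
  -- The order is arbitrary and only orients the edges.
  let _ : LinearOrder A := LinearOrder.lift' (Fintype.equivFin A) (Fintype.equivFin A).injective
  have hD' : ∀ a, (receivers t μ Finset.univ a).card ≤ D := fun a => by
    convert hD a
    rw [← Set.ncard_coe_finset]
    congr 1
    ext b
    simp [mem_receivers]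
  obtain ⟨col, hc1, hc2⟩ := exists_chromatic_coloring hD'
  obtain ⟨B, t', hB, hBc, h1, h2, h3⟩ := exists_small_restructuring_of_chromatic
    (κ := fun a => (t a a, col a)) hD'
    (fun a b h he => hc1 a b h (Prod.ext_iff.1 he).2)
    (fun a b b' h h' he => hc2 a b b' h h' (Prod.ext_iff.1 he).2) {x}
  refine ⟨B, t', hB (Finset.mem_singleton_self x), hBc.trans (le_of_eq ?_), h1, ?_, ?_⟩
  · simp only [Fintype.card_prod, Fintype.card_fin, Finset.card_singleton, restructuringBound]
  · intro a ha b hb hab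
    obtain ⟨a₀, b₀, h4, h5, h6, h7⟩ := h2 a ha b hb hab
    exact ⟨a₀, b₀, h4, (Prod.ext_iff.1 h5).1, (Prod.ext_iff.1 h6).1, h7⟩
  · intro a ha τ hτ
    have h := h3 a ha τ hτ
    rw [← Set.ncard_coe_finset, ← Set.ncard_coe_finset] at h
    simpa using h

end Surgery

/-! ### Transfer of capped witness counts -/

section Counting

theorem ncard_eq_of_fiberwise {α T : Type*} [Finite α] [Fintype T] {X Y : Set α}
    {f g : α → T} (p : T → Prop)
    (h : ∀ τ, p τ → {x | x ∈ X ∧ f x = τ}.ncard = {y | y ∈ Y ∧ g y = τ}.ncard) :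
    {x | x ∈ X ∧ p (f x)}.ncard = {y | y ∈ Y ∧ p (g y)}.ncard := by
  classical
  have := Fintype.ofFinite α
  have key : ∀ (X : Set α) (f : α → T), {x | x ∈ X ∧ p (f x)}.ncard =
      ∑ τ ∈ Finset.univ.filter p, {x | x ∈ X ∧ f x = τ}.ncard := by
    intro X f
    rw [Set.ncard_eq_toFinset_card', Finset.card_eq_sum_card_fiberwise (f := f)
      (t := Finset.univ.filter p) (fun x hx => by
        have : x ∈ X ∧ p (f x) := by simpa using hx
        simpa using this.2)]
    refine Finset.sum_congr rfl fun τ hτ => ?_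
    rw [Set.ncard_eq_toFinset_card']
    congr 1
    ext x
    simp only [Finset.mem_filter, Set.mem_toFinset, Set.mem_ofPred_eq, Finset.mem_univ,
      true_and] at hτ ⊢
    constructor
    · exact fun h => ⟨h.1.1, h.2⟩
    · exact fun h => ⟨⟨h.1, h.2 ▸ hτ⟩, h.2⟩
  rw [key, key]
  exact Finset.sum_congr rfl fun τ hτ => h τ (Finset.mem_filter.1 hτ).2

/-- `X` and `X'` are the old and new witnesses of `a`, `S` the chosen old ones, `M` the new
receivers of messages. Since no element sends messages to itself, `a` is treated separately. Below
the cap all witnesses are chosen, so `M` is everything but `a`; above it `M` and possibly `a`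
already reach the cap. -/
theorem min_ncard_eq_of_transfer {α : Type*} [Finite α] {X X' S M : Set α} {a : α} {n : ℕ}
    (hS : S ⊆ X) (hSn : S.ncard = min X.ncard n) (haM : a ∉ M)
    (hM : M.ncard = (S \ {a}).ncard) (ha : a ∈ X' ↔ a ∈ X) (hMX : M ⊆ X')
    (hX : X.ncard ≤ n → X' \ {a} ⊆ M) : min X'.ncard n = min X.ncard n := by
  have hrem : ∀ Y : Set α, a ∈ Y → (Y \ {a}).ncard + 1 = Y.ncard := fun Y hY =>
    Set.ncard_sdiff_singleton_add_one hY
  have hnot : ∀ Y : Set α, a ∉ Y → Y \ {a} = Y := fun Y hY => Set.sdiff_singleton_eq_self hY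
  have hMX' : M ⊆ X' \ {a} := fun x hx => ⟨hMX hx, fun h => haM (h ▸ hx)⟩
  by_cases hle : X.ncard ≤ n
  · have hSX : S = X := Set.eq_of_subset_of_ncard_le hS (by rw [hSn, min_eq_left hle])
    have hMX'' : M = X' \ {a} := hMX'.antisymm (hX hle)
    rw [hSX, hMX''] at hM
    congr 1
    by_cases haX : a ∈ X
    · rw [← hrem X haX, ← hrem X' (ha.2 haX), hM]
    · rw [hnot X haX, hnot X' (fun h => haX (ha.1 h))] at hM
      exact hM
  · rw [min_eq_right (not_le.1 hle).le] at hSn ⊢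
    refine min_eq_right ?_
    have h1 := Set.ncard_le_ncard hMX'
    by_cases haS : a ∈ S
    · rw [← hrem X' (ha.2 (hS haS)), ← hSn, ← hrem S haS, ← hM]
      omega
    · rw [hnot S haS] at hM
      have := Set.ncard_le_ncard (Set.sdiff_subset : X' \ {a} ⊆ X')
      omega

end Counting

/-! ### Numerical estimates -/

section Bounds

theorem zeroSumBound_mono {a b : ℕ} (h : a ≤ b) : zeroSumBound a ≤ zeroSumBound b := by
  unfold zeroSumBound
  refine add_le_add ?_ h
  calc (2 * a + 1) ^ a ≤ (2 * b + 1) ^ a := Nat.pow_le_pow_left (by omega) _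
    _ ≤ (2 * b + 1) ^ b := Nat.pow_le_pow_right (by omega) h

theorem restructuringBound_mono {n n' D D' : ℕ} (h : n ≤ n') (h' : D ≤ D') :
    restructuringBound n D ≤ restructuringBound n' D' := by
  unfold restructuringBound
  gcongr
  apply zeroSumBound_mono
  gcongr

theorem pow_le_two_pow {x k : ℕ} (hx : 2 ≤ x) (hk : k ≤ 32) : x ^ k ≤ 2 ^ x ^ 6 := by
  calc x ^ k ≤ (2 ^ x) ^ k := Nat.pow_le_pow_left Nat.lt_two_pow_self.le _
    _ = 2 ^ (x * k) := (pow_mul _ _ _).symm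
    _ ≤ 2 ^ x ^ 6 := Nat.pow_le_pow_right (by omega) (by
      have : 2 ^ 5 ≤ x ^ 5 := Nat.pow_le_pow_left hx 5
      calc x * k ≤ x * x ^ 5 := Nat.mul_le_mul_left _ (by omega)
        _ = x ^ 6 := by ring)

theorem zeroSumBound_le {x : ℕ} (hx : 2 ≤ x) : zeroSumBound (x ^ 24) ≤ 2 ^ x ^ 31 := by
  unfold zeroSumBound
  have h1 : 2 * x ^ 24 + 1 ≤ 2 ^ x ^ 6 := by
    refine le_trans ?_ (pow_le_two_pow hx (k := 26) (by norm_num))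
    have : 2 ^ 2 ≤ x ^ 2 := Nat.pow_le_pow_left hx 2
    have h0 : 1 ≤ x ^ 24 := Nat.one_le_pow _ _ (by omega)
    calc 2 * x ^ 24 + 1 ≤ x ^ 24 * 2 ^ 2 := by omega
      _ ≤ x ^ 24 * x ^ 2 := Nat.mul_le_mul_left _ this
      _ = x ^ 26 := by ring
  have h2 : (2 * x ^ 24 + 1) ^ x ^ 24 ≤ 2 ^ x ^ 30 := by
    calc (2 * x ^ 24 + 1) ^ x ^ 24 ≤ (2 ^ x ^ 6) ^ x ^ 24 := Nat.pow_le_pow_left h1 _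
      _ = 2 ^ x ^ 30 := by rw [← pow_mul, ← pow_add]
  have h3 : x ^ 24 ≤ 2 ^ x ^ 30 := (pow_le_two_pow hx (by norm_num)).trans
    (Nat.pow_le_pow_right (by omega) (Nat.pow_le_pow_right (by omega) (by norm_num)))
  calc _ ≤ 2 ^ x ^ 30 + 2 ^ x ^ 30 := add_le_add h2 h3
    _ = 2 ^ (x ^ 30 + 1) := by ring
    _ ≤ 2 ^ x ^ 31 := Nat.pow_le_pow_right (by omega) (by
      have h0 : 1 ≤ x ^ 30 := Nat.one_le_pow _ _ (by omega)
      calc x ^ 30 + 1 ≤ x ^ 30 * 2 := by omega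
        _ ≤ x ^ 30 * x := Nat.mul_le_mul_left _ hx
        _ = x ^ 31 := by ring)

/-- With `x` exponential in the size of the formula, `x ^ 3` bounds the number of pair labels and `x
^ 2` the number of messages. The dimension of the edge vectors is then at most `x ^ 24`, and the
zero-sum bound dominates. -/
theorem restructuringBound_le {x : ℕ} (hx : 2 ≤ x) :
    restructuringBound (x ^ 3) (x ^ 2) ≤ 2 ^ x ^ 32 := by
  have hp : ∀ {i j : ℕ}, i ≤ j → x ^ i ≤ x ^ j := fun h => Nat.pow_le_pow_right (by omega) h
  have h4 : 2 ^ 2 ≤ x ^ 2 := Nat.pow_le_pow_left hx 2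
  have hl : x ^ 3 * (x ^ 2 + x ^ 2 * x ^ 2 + 1) ≤ x ^ 9 := by
    calc x ^ 3 * (x ^ 2 + x ^ 2 * x ^ 2 + 1) ≤ x ^ 3 * (x ^ 2 * x ^ 2 * x ^ 2) :=
          Nat.mul_le_mul_left _ (by nlinarith)
      _ = x ^ 9 := by ring
  have hΘ : 6 * x ^ 2 + 2 ≤ x ^ 5 := by
    have h8 : 2 ^ 3 ≤ x ^ 3 := Nat.pow_le_pow_left hx 3
    calc 6 * x ^ 2 + 2 ≤ x ^ 2 * 2 ^ 3 := by omega
      _ ≤ x ^ 2 * x ^ 3 := Nat.mul_le_mul_left _ h8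
      _ = x ^ 5 := by ring
  have hlΘ : x ^ 3 * (x ^ 2 + x ^ 2 * x ^ 2 + 1) * (6 * x ^ 2 + 2) ≤ x ^ 14 :=
    (Nat.mul_le_mul hl hΘ).trans_eq (by ring)
  have hz : zeroSumBound (x ^ 3 * (x ^ 3 * ((x ^ 3 * (x ^ 2 + x ^ 2 * x ^ 2 + 1)) *
      (x ^ 3 * (x ^ 2 + x ^ 2 * x ^ 2 + 1))))) ≤ 2 ^ x ^ 31 :=
    (zeroSumBound_mono ((Nat.mul_le_mul_left _ (Nat.mul_le_mul_left _
      (Nat.mul_le_mul hl hl))).trans_eq (by ring))).trans (zeroSumBound_le hx)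
  unfold restructuringBound
  have h1 : 1 ≤ 2 ^ x ^ 31 := Nat.one_le_two_pow
  have h14 : x ^ 14 ≤ x ^ 16 := hp (by norm_num)
  have h16 : 1 ≤ x ^ 16 := Nat.one_le_pow _ _ (by omega)
  calc _ ≤ x ^ 14 + (1 + x ^ 14 * x ^ 2 + x ^ 14) * 2 ^ x ^ 31 := by gcongr
    _ ≤ x ^ 14 * 2 ^ x ^ 31 + (1 + x ^ 14 * x ^ 2 + x ^ 14) * 2 ^ x ^ 31 :=
      Nat.add_le_add_right (Nat.le_mul_of_pos_right _ h1) _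
    _ = (x ^ 14 + (1 + x ^ 16 + x ^ 14)) * 2 ^ x ^ 31 := by ring
    _ ≤ x ^ 18 * 2 ^ x ^ 31 := by
      refine Nat.mul_le_mul_right _ ?_
      calc x ^ 14 + (1 + x ^ 16 + x ^ 14) ≤ x ^ 16 * 2 ^ 2 := by omega
        _ ≤ x ^ 16 * x ^ 2 := Nat.mul_le_mul_left _ h4
        _ = x ^ 18 := by ring
    _ ≤ 2 ^ x ^ 6 * 2 ^ x ^ 31 := Nat.mul_le_mul_right _ (pow_le_two_pow hx (by norm_num))
    _ = 2 ^ (x ^ 6 + x ^ 31) := (pow_add _ _ _).symm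
    _ ≤ 2 ^ x ^ 32 := Nat.pow_le_pow_right (by omega) (by
      have h6 : x ^ 6 ≤ x ^ 31 := hp (by norm_num)
      calc x ^ 6 + x ^ 31 ≤ x ^ 31 * 2 := by omega
        _ ≤ x ^ 31 * x := Nat.mul_le_mul_left _ hx
        _ = x ^ 32 := by ring)

end Bounds

/-! ### From formulas to pair labels and back -/

namespace C2

open FirstOrder

variable {P R : Type u}

/-- The structure with given interpretations of the predicates. -/
@[reducible]
def structureOf {B : Type*} (p : P → B → Prop) (r : R → B → B → Prop) : (sig P R).Structure B where
  funMap f := Empty.elim f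
  RelMap {n} s xs := match n, s, xs with
    | 0, s, _ => PEmpty.elim s
    | 1, s, xs => p s (xs 0)
    | 2, s, xs => r s (xs 0) (xs 1)
    | _ + 3, s, _ => PEmpty.elim s

namespace Formula

/-- A quantifier as a condition on the number of elements that satisfy, or violate, its body;
only the minimum of this number and `cap` matters. -/
structure Quantifier (P R : Type u) where
  var : Fin 2
  body : Formula P R
  sign : Prop → Prop
  cap : ℕ
  test : ℕ → Prop

/-- The leading quantifier of a formula. -/
def quantifier : Formula P R → Option (Quantifier P R)
  | all i φ => some ⟨i, φ, Not, 1, fun n => n = 0⟩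
  | ex i φ => some ⟨i, φ, id, 1, fun n => n ≠ 0⟩
  | exLE C i φ => some ⟨i, φ, id, C + 1, fun n => n ≤ C⟩
  | exGE C i φ => some ⟨i, φ, id, C, fun n => C ≤ n⟩
  | exEQ C i φ => some ⟨i, φ, id, C + 1, fun n => n = C⟩
  | _ => none

/-- The elements that count for a quantifier if the other variable denotes `a`. -/
def Quantifier.witnesses {A : Type*} [(sig P R).Structure A] (q : Quantifier P R) (a : A) : Set A :=
  {b | q.sign (q.body.Realize (Function.update (fun _ => a) q.var b))}

theorem update_eq_update_const {A : Type*} (v : Fin 2 → A) (i : Fin 2) (b : A) :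
    Function.update v i b = Function.update (fun _ => v (1 - i)) i b := by
  funext j
  fin_cases i <;> fin_cases j <;> simp [Function.update]

theorem Quantifier.mem_witnesses {A : Type*} [(sig P R).Structure A] (q : Quantifier P R)
    (a b : A) : b ∈ q.witnesses a ↔
      q.sign (q.body.Realize (if q.var = 0 then ![b, a] else ![a, b])) := by
  have h : Function.update (fun _ => a) q.var b = if q.var = 0 then ![b, a] else ![a, b] := by
    obtain ⟨i, -⟩ := q
    funext j
    fin_cases i <;> fin_cases j <;> simp [Function.update]
  rw [← h]
  rfl

/-- The cap is `C + 1` for "at most" and "exactly", where `C` must be told apart from more, and `C`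
for "at least". For the universal quantifier the witnesses counted are counterexamples, and one
suffices. -/
theorem realize_iff_test {A : Type*} [Finite A] [(sig P R).Structure A] {χ : Formula P R}
    {q : Quantifier P R} (h : χ.quantifier = some q) (v : Fin 2 → A) :
    χ.Realize v ↔ q.test (min (q.witnesses (v (1 - q.var))).ncard q.cap) := by
  have hfin : ∀ s : Set A, s.encard = (s.ncard : ℕ∞) := fun s => (s.toFinite.cast_ncard_eq).symm
  cases χ with
  | all i φ =>
    obtain rfl := Option.some.inj h
    simp only [Quantifier.witnesses, ← update_eq_update_const, Realize]
    rw [show (min (Set.ncard {b | ¬ φ.Realize (Function.update v i b)}) 1 = 0 ↔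
      Set.ncard {b | ¬ φ.Realize (Function.update v i b)} = 0) by omega,
      Set.ncard_eq_zero, Set.eq_empty_iff_forall_notMem]
    simp
  | ex i φ =>
    obtain rfl := Option.some.inj h
    simp only [Quantifier.witnesses, ← update_eq_update_const, Realize, id]
    rw [show (min (Set.ncard {b | φ.Realize (Function.update v i b)}) 1 ≠ 0 ↔
      Set.ncard {b | φ.Realize (Function.update v i b)} ≠ 0) by omega,
      Ne, Set.ncard_eq_zero, ← Ne, ← Set.nonempty_iff_ne_empty]
    rfl
  | exLE C i φ =>
    obtain rfl := Option.some.inj h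
    simp only [Quantifier.witnesses, ← update_eq_update_const, Realize, id, hfin, Nat.cast_le]
    omega
  | exGE C i φ =>
    obtain rfl := Option.some.inj h
    simp only [Quantifier.witnesses, ← update_eq_update_const, Realize, id, hfin, Nat.cast_le]
    omega
  | exEQ C i φ =>
    obtain rfl := Option.some.inj h
    simp only [Quantifier.witnesses, ← update_eq_update_const, Realize, id, hfin, Nat.cast_inj]
    omega
  | _ => cases h

theorem cap_le_two_pow_size {χ : Formula P R} {q : Quantifier P R} (h : χ.quantifier = some q) :
    q.cap ≤ 2 ^ χ.size := by
  have hC : ∀ (C : ℕ+) (k : ℕ), (C : ℕ) + 1 ≤ 2 ^ (k + 2 + Nat.log 2 C) := fun C k =>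
    (Nat.lt_pow_succ_log_self (by norm_num) (C : ℕ)).trans_le
      (Nat.pow_le_pow_right (by norm_num) (by omega))
  cases χ with
  | all i φ => obtain rfl := Option.some.inj h; exact Nat.one_le_two_pow
  | ex i φ => obtain rfl := Option.some.inj h; exact Nat.one_le_two_pow
  | exLE C i φ => obtain rfl := Option.some.inj h; exact hC C _
  | exGE C i φ => obtain rfl := Option.some.inj h; exact (Nat.le_succ _).trans (hC C _)
  | exEQ C i φ => obtain rfl := Option.some.inj h; exact hC C _
  | _ => cases h

open Classical in
/-- The subformulas of a formula. -/
noncomputable def subformulas : Formula P R → Finset (Formula P R)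
  | neg φ => insert (neg φ) φ.subformulas
  | and φ ψ => insert (and φ ψ) (φ.subformulas ∪ ψ.subformulas)
  | or φ ψ => insert (or φ ψ) (φ.subformulas ∪ ψ.subformulas)
  | imp φ ψ => insert (imp φ ψ) (φ.subformulas ∪ ψ.subformulas)
  | iff φ ψ => insert (iff φ ψ) (φ.subformulas ∪ ψ.subformulas)
  | all i φ => insert (all i φ) φ.subformulas
  | ex i φ => insert (ex i φ) φ.subformulas
  | exLE C i φ => insert (exLE C i φ) φ.subformulas
  | exGE C i φ => insert (exGE C i φ) φ.subformulas
  | exEQ C i φ => insert (exEQ C i φ) φ.subformulas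
  | φ => {φ}

theorem mem_subformulas_self (φ : Formula P R) : φ ∈ φ.subformulas := by
  cases φ <;> simp [subformulas]

theorem one_le_size (φ : Formula P R) : 1 ≤ φ.size := by
  cases φ <;> simp only [size] <;> omega

theorem card_subformulas_le (φ : Formula P R) : φ.subformulas.card ≤ φ.size := by
  classical
  induction φ with
  | eq i j => simp [subformulas, size]
  | unary p i => simp [subformulas, size]
  | binary r i j => simp [subformulas, size]
  | and φ ψ h1 h2 | or φ ψ h1 h2 | imp φ ψ h1 h2 | iff φ ψ h1 h2 =>
    simp only [subformulas, size]
    exact (Finset.card_insert_le _ _).trans (Nat.add_le_add_right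
      ((Finset.card_union_le _ _).trans (add_le_add h1 h2)) 1)
  | neg φ h | all i φ h | ex i φ h | exLE C i φ h | exGE C i φ h | exEQ C i φ h =>
    simp only [subformulas, size]
    refine (Finset.card_insert_le _ _).trans ?_
    omega

theorem size_le_of_mem_subformulas {φ χ : Formula P R} (h : χ ∈ φ.subformulas) :
    χ.size ≤ φ.size := by
  classical
  induction φ with
  | eq i j => rw [Finset.mem_singleton.1 h]
  | unary p i => rw [Finset.mem_singleton.1 h]
  | binary r i j => rw [Finset.mem_singleton.1 h]
  | and φ ψ h1 h2 | or φ ψ h1 h2 | imp φ ψ h1 h2 | iff φ ψ h1 h2 =>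
    simp only [subformulas, Finset.mem_insert, Finset.mem_union] at h
    rcases h with rfl | h | h
    · exact le_rfl
    · have := h1 h
      simp only [size]
      omega
    · have := h2 h
      simp only [size]
      omega
  | neg φ h1 | all i φ h1 | ex i φ h1 | exLE C i φ h1 | exGE C i φ h1 | exEQ C i φ h1 =>
    simp only [subformulas, Finset.mem_insert] at h
    rcases h with rfl | h
    · exact le_rfl
    · have := h1 h
      simp only [size]
      omega

theorem subformulas_body_subset {χ : Formula P R} {q : Quantifier P R}
    (h : χ.quantifier = some q) : q.body.subformulas ⊆ χ.subformulas := by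
  classical
  cases χ with
  | all i φ => obtain rfl := Option.some.inj h; exact Finset.subset_insert _ _
  | ex i φ => obtain rfl := Option.some.inj h; exact Finset.subset_insert _ _
  | exLE C i φ => obtain rfl := Option.some.inj h; exact Finset.subset_insert _ _
  | exGE C i φ => obtain rfl := Option.some.inj h; exact Finset.subset_insert _ _
  | exEQ C i φ => obtain rfl := Option.some.inj h; exact Finset.subset_insert _ _
  | _ => cases h

/-- What is recorded about a pair `(a, b)`: the subformulas of `φ` that it satisfies, the
quantified subformulas for which `b` is a chosen witness of `a`, and those for which all witnesses
of `a` are chosen. -/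
abbrev PairLabel (φ : Formula P R) : Type u :=
  (φ.subformulas → Prop) × (φ.subformulas → Prop) × (φ.subformulas → Prop)

open Classical in
theorem card_pairLabel_le (φ : Formula P R) :
    Fintype.card φ.PairLabel ≤ (2 ^ φ.size) ^ 3 := by
  have h : 2 ^ φ.subformulas.card ≤ 2 ^ φ.size :=
    Nat.pow_le_pow_right (by norm_num) φ.card_subformulas_le
  simp only [PairLabel, Fintype.card_prod, Fintype.card_fun, Fintype.card_prop, Fintype.card_coe]
  calc _ ≤ 2 ^ φ.size * (2 ^ φ.size * 2 ^ φ.size) := by gcongr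
    _ = _ := by ring

theorem exists_chosen_witnesses {A : Type*} [Finite A] [(sig P R).Structure A] (χ : Formula P R)
    (a : A) : ∃ S : Set A, S.ncard ≤ 2 ^ χ.size ∧ ∀ q, χ.quantifier = some q →
      S ⊆ q.witnesses a ∧ S.ncard = min (q.witnesses a).ncard q.cap := by
  cases h : χ.quantifier with
  | none => exact ⟨∅, by simp, fun q hq => by cases hq⟩
  | some q =>
    obtain ⟨S, hS, hSc⟩ := Set.exists_subset_card_eq
      (min_le_left (q.witnesses a).ncard q.cap)
    refine ⟨S, hSc.trans_le ((min_le_right _ _).trans (cap_le_two_pow_size h)), ?_⟩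
    rintro q' ⟨⟩
    exact ⟨hS, hSc⟩

/-- By induction on subformulas, the new pair label of `(a, b)` tells the truth about `(a, b)` in
the new structure. Boolean cases are immediate, since the label is copied from an actual pair. A
quantified subformula depends on one element only, and preserved message counts give that element
the same capped number of witnesses as before. -/
theorem exists_small_model {A : Type} [Finite A] [(sig P R).Structure A] (φ : Formula P R)
    {a : A} (ha : φ.Realize ![a, a]) :
    ∃ (B : Type) (_ : Finite B) (_ : (sig P R).Structure B),
      (∃ b : B, φ.Realize ![b, b]) ∧
      Nat.card B ≤ restructuringBound ((2 ^ φ.size) ^ 3) ((2 ^ φ.size) ^ 2) := by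
  classical
  choose S hSle hS using fun (χ : Formula P R) (a : A) => exists_chosen_witnesses χ a
  let t : A → A → φ.PairLabel := fun a b =>
    (fun χ => χ.1.Realize ![a, b], fun χ => b ∈ S χ.1 a,
      fun χ => ∀ q, χ.1.quantifier = some q → (q.witnesses a).ncard ≤ q.cap)
  have hD : ∀ a, {b | b ≠ a ∧ ∃ χ, (t a b).2.1 χ}.ncard ≤ (2 ^ φ.size) ^ 2 := by
    intro a
    have hsub : {b | b ≠ a ∧ ∃ χ, (t a b).2.1 χ} ⊆ ⋃ χ : φ.subformulas, S χ.1 a := by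
      rintro b ⟨-, χ, hχ⟩
      exact Set.mem_iUnion.2 ⟨χ, hχ⟩
    calc _ ≤ (⋃ χ : φ.subformulas, S χ.1 a).ncard := Set.ncard_le_ncard hsub
      _ ≤ ∑ χ : φ.subformulas, (S χ.1 a).ncard := Set.ncard_iUnion_le_of_fintype _
      _ ≤ ∑ _χ : φ.subformulas, 2 ^ φ.size := Finset.sum_le_sum fun χ _ =>
        (hSle χ.1 a).trans (Nat.pow_le_pow_right (by norm_num) (size_le_of_mem_subformulas χ.2))
      _ ≤ 2 ^ φ.size * 2 ^ φ.size := by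
        rw [Finset.sum_const, smul_eq_mul, Finset.card_univ, Fintype.card_coe]
        exact Nat.mul_le_mul_right _ (φ.card_subformulas_le.trans Nat.lt_two_pow_self.le)
      _ = _ := (sq _).symm
  obtain ⟨B, t', haB, hBc, hdiag, hpair, hcount⟩ := exists_small_restructuring
    (μ := fun τ : φ.PairLabel => ∃ χ, τ.2.1 χ) hD a
  -- Diagonal pairs are included, each copying itself, so that `x` and `y` name a pattern for every
  -- pair in `B`.
  have hpair' : ∀ a b, ∃ a₀ b₀, a ∈ B → b ∈ B → (a₀ = b₀ ↔ a = b) ∧ t a₀ a₀ = t a a ∧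
      t b₀ b₀ = t b b ∧ t' a b = t a₀ b₀ ∧ t' b a = t b₀ a₀ := by
    intro a b
    by_cases hab : a = b
    · subst hab
      exact ⟨a, a, fun _ _ => ⟨by simp, rfl, rfl, hdiag a, hdiag a⟩⟩
    by_cases hB : a ∈ B ∧ b ∈ B
    · obtain ⟨a₀, b₀, hne, h⟩ := hpair a hB.1 b hB.2 hab
      exact ⟨a₀, b₀, fun _ _ => ⟨by simp [hne, hab], h⟩⟩
    · exact ⟨a, b, fun ha hb => absurd ⟨ha, hb⟩ hB⟩
  choose x y hxy using hpair'
  let str : (sig P R).Structure B := structureOf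
    (fun p a => Language.Structure.RelMap (L := sig P R) (n := 1) (M := A) p ![a.1])
    (fun r a b => Language.Structure.RelMap (L := sig P R) (n := 2) (M := A) r
      ![x a.1 b.1, y a.1 b.1])
  have key : ∀ χ : Formula P R, ∀ hχ : χ.subformulas ⊆ φ.subformulas, ∀ a b : B,
      χ.Realize ![a, b] ↔ (t' a.1 b.1).1 ⟨χ, hχ χ.mem_subformulas_self⟩ := by
    have htruth : ∀ χ : Formula P R, χ ∈ φ.subformulas → ∀ {a b c d : A}, t a b = t c d →
        (χ.Realize ![a, b] ↔ χ.Realize ![c, d]) := fun χ hχ a b c d h =>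
      iff_of_eq (congrFun (congrArg Prod.fst h) ⟨χ, hχ⟩)
    have hquant : ∀ (χ : Formula P R) (q : Quantifier P R) (hq : χ.quantifier = some q)
        (hχ : χ.subformulas ⊆ φ.subformulas), (∀ a b : B, q.body.Realize ![a, b] ↔
          (t' a.1 b.1).1 ⟨q.body, hχ (subformulas_body_subset hq q.body.mem_subformulas_self)⟩) →
        ∀ a b : B, χ.Realize ![a, b] ↔ (t' a.1 b.1).1 ⟨χ, hχ χ.mem_subformulas_self⟩ := by
      intro χ q hq hχ ih
      have hχφ := hχ χ.mem_subformulas_self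
      have hwit : ∀ (a b : B) (a₀ b₀ : A), t' a.1 b.1 = t a₀ b₀ → t' b.1 a.1 = t b₀ a₀ →
          (b ∈ q.witnesses a ↔ b₀ ∈ q.witnesses a₀) := by
        intro a b a₀ b₀ h1 h2
        rw [q.mem_witnesses, q.mem_witnesses]
        refine iff_of_eq (congrArg q.sign (propext ?_))
        split_ifs
        · rw [ih, h2]
        · rw [ih, h1]
      have hmin : ∀ a : B, min (q.witnesses a).ncard q.cap =
          min (q.witnesses a.1).ncard q.cap := by
        intro a
        rw [← Set.ncard_image_of_injective _ Subtype.val_injective]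
        obtain ⟨hS1, hS2⟩ := hS χ a.1 q hq
        refine min_ncard_eq_of_transfer (a := a.1) hS1 hS2
          (M := {b | (b ∈ B ∧ b ≠ a.1) ∧ (t' a.1 b).2.1 ⟨χ, hχφ⟩}) (fun h => h.1.2 rfl) ?_ ?_ ?_ ?_
        · have h := ncard_eq_of_fiberwise (X := {b | b ∈ B ∧ b ≠ a.1}) (Y := {b | b ≠ a.1})
            (f := t' a.1) (g := t a.1) (fun τ => τ.2.1 ⟨χ, hχφ⟩) fun τ hτ => by
              have h := hcount a.1 a.2 τ ⟨_, hτ⟩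
              simpa only [Set.mem_ofPred_eq, and_assoc] using h
          refine h.trans (congrArg Set.ncard (Set.ext fun b => ?_))
          exact and_comm
        · rw [← hwit a a a.1 a.1 (hdiag _) (hdiag _)]
          simp
        · rintro b ⟨⟨hb, hba⟩, hm⟩
          obtain ⟨-, -, -, h4, h5⟩ := hxy a.1 b a.2 hb
          rw [h4] at hm
          exact ⟨⟨b, hb⟩, (hwit a ⟨b, hb⟩ _ _ h4 h5).2 ((hS χ _ q hq).1 hm), rfl⟩
        · rintro hle _ ⟨⟨b, hb, rfl⟩, hba⟩
          refine ⟨⟨b.2, hba⟩, ?_⟩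
          obtain ⟨-, h2, -, h4, h5⟩ := hxy a.1 b.1 a.2 b.2
          -- This is the purpose of the third label component: it depends on the first element
          -- alone, so it passes from `a` to `x a b` through their common diagonal label. All
          -- witnesses of `x a b` are therefore chosen, and the copied pair cannot bring in a
          -- witness that is not the receiver of a message.
          have hle' : (q.witnesses (x a.1 b.1)).ncard ≤ q.cap := by
            have h : (t a.1 a.1).2.2 ⟨χ, hχφ⟩ := by
              intro q' hq'
              obtain rfl := Option.some.inj (hq.symm.trans hq')
              exact hle
            rw [← h2] at h
            exact h q hq
          obtain ⟨hS3, hS4⟩ := hS χ (x a.1 b.1) q hq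
          have hall : S χ (x a.1 b.1) = q.witnesses (x a.1 b.1) :=
            Set.eq_of_subset_of_ncard_le hS3 (by rw [hS4, min_eq_left hle'])
          rw [h4]
          change y a.1 b.1 ∈ S χ (x a.1 b.1)
          rw [hall]
          exact (hwit a b _ _ h4 h5).1 hb
      -- The truth of a quantified subformula at a pair is already recorded in the diagonal label of
      -- its free element.
      have hself : ∀ a b c : A, ![a, b] (1 - q.var) = c →
          (χ.Realize ![a, b] ↔ χ.Realize ![c, c]) := by
        intro a b c h
        rw [realize_iff_test hq, realize_iff_test hq, h]
        have : ![c, c] (1 - q.var) = c := by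
          generalize 1 - q.var = i
          fin_cases i <;> rfl
        rw [this]
      intro a b
      obtain ⟨-, h2, h3, h4, -⟩ := hxy a.1 b.1 a.2 b.2
      rw [h4]
      change _ ↔ χ.Realize ![x a.1 b.1, y a.1 b.1]
      rw [hself _ _ _ rfl, realize_iff_test hq, hmin,
        show ((![a, b] (1 - q.var) : B) : A) = ![a.1, b.1] (1 - q.var) by
          generalize 1 - q.var = i
          fin_cases i <;> rfl, ← realize_iff_test hq ![a.1, b.1], hself _ _ _ rfl]
      generalize 1 - q.var = i
      fin_cases i
      · exact htruth χ hχφ h2.symm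
      · exact htruth χ hχφ h3.symm
    intro χ
    induction χ with
    | eq i j =>
      intro hχ a b
      obtain ⟨h1, h2, h3, h4, -⟩ := hxy a.1 b.1 a.2 b.2
      rw [h4]
      change _ ↔ ![x a.1 b.1, y a.1 b.1] i = ![x a.1 b.1, y a.1 b.1] j
      fin_cases i <;> fin_cases j
      · exact iff_of_true rfl rfl
      · exact Subtype.ext_iff.trans h1.symm
      · exact eq_comm.trans ((Subtype.ext_iff.trans h1.symm).trans eq_comm)
      · exact iff_of_true rfl rfl
    | unary p i =>
      intro hχ a b
      obtain ⟨h1, h2, h3, h4, -⟩ := hxy a.1 b.1 a.2 b.2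
      rw [h4]
      have hmem := hχ (mem_subformulas_self _)
      fin_cases i
      · have h := htruth _ hmem h2.symm
        exact h
      · have h := htruth _ hmem h3.symm
        exact h
    | binary r i j =>
      intro hχ a b
      obtain ⟨h1, h2, h3, h4, -⟩ := hxy a.1 b.1 a.2 b.2
      have hmem := hχ (mem_subformulas_self _)
      have hdia : ∀ a : B, y a.1 a.1 = x a.1 a.1 ∧ t (x a.1 a.1) (x a.1 a.1) = t a.1 a.1 :=
        fun a => ⟨((hxy a.1 a.1 a.2 a.2).1.2 rfl).symm, (hxy a.1 a.1 a.2 a.2).2.1⟩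
      fin_cases i <;> fin_cases j
      · rw [h4]
        have h := htruth _ hmem ((hdia a).2.trans h2.symm)
        change Language.Structure.RelMap (L := sig P R) (n := 2) (M := A) r
          ![x a.1 a.1, y a.1 a.1] ↔ _
        rw [(hdia a).1]
        exact h
      · rw [h4]
        exact Iff.rfl
      · rw [(hxy b.1 a.1 b.2 a.2).2.2.2.2]
        exact Iff.rfl
      · rw [h4]
        have h := htruth _ hmem ((hdia b).2.trans h3.symm)
        change Language.Structure.RelMap (L := sig P R) (n := 2) (M := A) r
          ![x b.1 b.1, y b.1 b.1] ↔ _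
        rw [(hdia b).1]
        exact h
    | neg χ ih =>
      intro hχ a b
      have ih := ih ((Finset.subset_insert _ _).trans hχ) a b
      obtain ⟨-, -, -, h4, -⟩ := hxy a.1 b.1 a.2 b.2
      rw [h4] at ih ⊢
      exact not_congr ih
    | and χ ψ ih₁ ih₂ =>
      intro hχ a b
      have ih₁ := ih₁ ((Finset.subset_union_left.trans (Finset.subset_insert _ _)).trans hχ) a b
      have ih₂ := ih₂ ((Finset.subset_union_right.trans (Finset.subset_insert _ _)).trans hχ) a b
      obtain ⟨-, -, -, h4, -⟩ := hxy a.1 b.1 a.2 b.2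
      rw [h4] at ih₁ ih₂ ⊢
      exact and_congr ih₁ ih₂
    | or χ ψ ih₁ ih₂ =>
      intro hχ a b
      have ih₁ := ih₁ ((Finset.subset_union_left.trans (Finset.subset_insert _ _)).trans hχ) a b
      have ih₂ := ih₂ ((Finset.subset_union_right.trans (Finset.subset_insert _ _)).trans hχ) a b
      obtain ⟨-, -, -, h4, -⟩ := hxy a.1 b.1 a.2 b.2
      rw [h4] at ih₁ ih₂ ⊢
      exact or_congr ih₁ ih₂
    | imp χ ψ ih₁ ih₂ =>
      intro hχ a b
      have ih₁ := ih₁ ((Finset.subset_union_left.trans (Finset.subset_insert _ _)).trans hχ) a b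
      have ih₂ := ih₂ ((Finset.subset_union_right.trans (Finset.subset_insert _ _)).trans hχ) a b
      obtain ⟨-, -, -, h4, -⟩ := hxy a.1 b.1 a.2 b.2
      rw [h4] at ih₁ ih₂ ⊢
      exact imp_congr ih₁ ih₂
    | iff χ ψ ih₁ ih₂ =>
      intro hχ a b
      have ih₁ := ih₁ ((Finset.subset_union_left.trans (Finset.subset_insert _ _)).trans hχ) a b
      have ih₂ := ih₂ ((Finset.subset_union_right.trans (Finset.subset_insert _ _)).trans hχ) a b
      obtain ⟨-, -, -, h4, -⟩ := hxy a.1 b.1 a.2 b.2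
      rw [h4] at ih₁ ih₂ ⊢
      exact iff_congr ih₁ ih₂
    | all i χ ih | ex i χ ih | exLE C i χ ih | exGE C i χ ih | exEQ C i χ ih =>
      exact fun hχ => hquant _ _ rfl hχ (ih ((subformulas_body_subset rfl).trans hχ))
  refine ⟨B, inferInstance, str, ⟨⟨a, haB⟩, ?_⟩, ?_⟩
  · rw [key φ subset_rfl, hdiag]
    exact ha
  · rw [Nat.card_eq_fintype_card, Fintype.card_coe]
    exact hBc.trans (restructuringBound_mono φ.card_pairLabel_le le_rfl)

end Formula

end C2

/-! ### The doubly exponential bound -/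

theorem mainTheorem3 :
    ∃ p : Polynomial ℕ, ∀ (P R : Type u) (φ : C2.Formula P R), φ.FinitelySatisfiable →
      ∃ (A : Type) (_ : Finite A) (_ : (C2.sig P R).Structure A),
        φ.SatisfiedIn A ∧ Nat.card A ≤ 2 ^ 2 ^ p.eval φ.size := by
  -- Closing `φ` under two existential quantifiers, so that it can be evaluated on the diagonal,
  -- adds 4 symbols. The exponent 32 comes from `restructuringBound_le` with `x = 2 ^ (φ.size + 4)`.
  refine ⟨32 * (Polynomial.X + 4), fun P R φ ⟨A, _, _, v, hv⟩ => ?_⟩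
  have hv' : (C2.Formula.ex 0 (C2.Formula.ex 1 φ)).Realize ![v 0, v 0] := by
    refine ⟨v 0, v 1, ?_⟩
    convert hv using 1
    funext j
    fin_cases j <;> rfl
  obtain ⟨B, hB, str, ⟨b, b₀, b₁, hb⟩, hcard⟩ := C2.Formula.exists_small_model _ hv'
  refine ⟨B, hB, str, ⟨_, hb⟩, hcard.trans ((restructuringBound_le ?_).trans_eq ?_)⟩
  · calc 2 = 2 ^ 1 := rfl
      _ ≤ _ := Nat.pow_le_pow_right (by norm_num) (C2.Formula.one_le_size _)
  · rw [← pow_mul]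
    simp [C2.Formula.size, mul_comm]
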